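/- All graphs are finite and simple. A graph is \emph{1-planar} if it can be drawn in the plane with at most one crossing per edge, and a graph with $n\ge 3$ vertices is \emph{optimal 1-planar} if it is 1-planar and has exactly $4n-8$ edges. For $k\ge 3$ the \emph{extended wheel graph} $XW_{2k}$ consists of a cycle $(v_1,\dots,v_{2k})$, all edges between vertices at distance two on this cycle, and two non-adjacent vertices (poles), each adjacent to every $v_i$. Let $x$ be a vertex of degree six of a graph $G$ whose neighbours can be labelled $x_1,\dots,x_6$ so that $G$ contains the edges of the hexagon $(x_1,x_2,x_3,x_4,x_5,x_6)$ and of the triangle $(x_1,x_3,x_5)$, and does not contain the edges $\{x_2,x_4\}$, $\{x_6,x_4\}$, $\{x_1,x_4\}$. Then the (feasible) \emph{$SR$-reduction} $SR(x\mapsto x_4)$ transforms $G$ into the graph $G'$ obtained from $G$ by deleting the vertex $x$ and the edge $\{x_3,x_5\}$ and adding the edges $\{x_4,x_1\}$, $\{x_4,x_2\}$, $\{x_4,x_6\}$. A \emph{separating 4-cycle} of $G$ is a cycle of length four in $G$ such that removing its four vertices leaves a disconnected graph. Then: (1) The 5-connected optimal 1-planar graphs are not closed under $SR$-reductions: there are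 a 5-connected optimal 1-planar graph $G$ and an $SR$-reduction of $G$ to an optimal 1-planar graph $G'$ that is not 5-connected. (2) If $G$ is an optimal 1-planar graph with a separating 4-cycle and $H$ is obtained from $G$ by a finite (possibly empty) sequence of $SR$-reductions, then $H$ is not (isomorphic to) an extended wheel graph. -/

import Mathlib

universe u v

namespace OptimalOnePlanar

section Planarity

variable {V : Type u}

/-- Reversal of darts (half-edges), as a permutation. -/
def reversePerm (G : SimpleGraph V) : Equiv.Perm G.Dart :=
  Function.Involutive.toPerm (SimpleGraph.Dart.symm (G := G))
    SimpleGraph.Dart.symm_involutive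

/-- A rotation system: a permutation of the darts whose cycles are exactly the sets of darts
leaving a common vertex, i.e. a cyclic order of the edges around each vertex. -/
def IsRotationSystem (G : SimpleGraph V) (σ : Equiv.Perm G.Dart) : Prop :=
  ∀ d e : G.Dart, σ.SameCycle d e ↔ d.fst = e.fst

/-- The number of facial walks of a rotation system, i.e. the number of cycles of the permutation
that sends a dart to the rotation successor of its reversal. -/
noncomputable def faceCount (G : SimpleGraph V) (σ : Equiv.Perm G.Dart) : ℕ :=
  Nat.card (Quotient (Equiv.Perm.SameCycle.setoid (σ * reversePerm G)))

/-- The rotation system `σ` of the finite graph `G` describes a planar embedding: every connected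
component satisfies Euler's formula `|V| - |E| + |F| = 2`. As `|V| - |E| + |F| ≤ 2` holds for
every component, it suffices to sum over the components. An isolated vertex has one
face, but no dart, hence these faces are counted separately. -/
def IsPlanarRotation (G : SimpleGraph V) (σ : Equiv.Perm G.Dart) : Prop :=
  IsRotationSystem G σ ∧
    Nat.card V + (faceCount G σ + {v : V | ∀ w, ¬ G.Adj v w}.ncard) =
      G.edgeSet.ncard + 2 * Nat.card G.ConnectedComponent

/-- The combinatorial part of a 1-planar drawing of `G`: the set of unordered pairs of crossing
edges. Each edge is crossed at most once. As usual, edges with a common endpoint do not cross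
(such a crossing can always be removed by exchanging the two initial segments). -/
structure CrossingPattern (G : SimpleGraph V) where
  /-- The unordered pairs of crossing edges. -/
  pairs : Set (Sym2 (Sym2 V))
  isEdge : ∀ p ∈ pairs, ∀ e ∈ p, e ∈ G.edgeSet
  disjoint : ∀ e f : Sym2 V, s(e, f) ∈ pairs → ∀ w, w ∈ e → w ∉ f
  crossedOnce : ∀ p ∈ pairs, ∀ q ∈ pairs, ∀ e, e ∈ p → e ∈ q → p = q

/-- The planarization: uncrossed edges are kept, and every crossing is a virtual vertex adjacent
to the four endpoints of the two crossing edges. -/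
def CrossingPattern.planarization {G : SimpleGraph V} (C : CrossingPattern G) :
    SimpleGraph (V ⊕ C.pairs) where
  Adj a b := match a, b with
    | Sum.inl a, Sum.inl b => G.Adj a b ∧ ∀ p ∈ C.pairs, s(a, b) ∉ p
    | Sum.inl a, Sum.inr p => ∃ e ∈ p.1, a ∈ e
    | Sum.inr p, Sum.inl a => ∃ e ∈ p.1, a ∈ e
    | Sum.inr _, Sum.inr _ => False
  symm := ⟨by
    rintro (a | p) (b | q) h
    · exact ⟨h.1.symm, fun p hp => by rw [Sym2.eq_swap]; exact h.2 p hp⟩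
    · exact h
    · exact h
    · exact h⟩
  loopless := ⟨by
    rintro (a | p) h
    · exact G.loopless.irrefl a h.1
    · exact h⟩

/-- A finite graph is 1-planar if it has a 1-planar embedding, given by an embedding of the
planarization, i.e. a planar rotation system, in which the two halves of a crossed edge are
opposite to each other at the crossing point. -/
def IsOnePlanar (G : SimpleGraph V) : Prop :=
  ∃ (C : CrossingPattern G) (σ : Equiv.Perm C.planarization.Dart),
    IsPlanarRotation C.planarization σ ∧
    ∀ (d : C.planarization.Dart) (p : C.pairs) (a b : V),
      d.fst = Sum.inr p → d.snd = Sum.inl a → s(a, b) ∈ p.1 → (σ (σ d)).snd = Sum.inl b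

/-- A graph with `n` vertices is optimal 1-planar if it is 1-planar and has `4 n - 8` edges,
which is the maximum for `n ≥ 3`. -/
def IsOptimalOnePlanar (G : SimpleGraph V) : Prop :=
  3 ≤ Nat.card V ∧ IsOnePlanar G ∧ G.edgeSet.ncard + 8 = 4 * Nat.card V

end Planarity

section Connectivity

variable {V : Type u}

/-- A finite graph is `k`-connected if it has more than `k` vertices and it stays connected after
the removal of fewer than `k` vertices. -/
def IsKConnected (k : ℕ) (G : SimpleGraph V) : Prop :=
  k < Nat.card V ∧ ∀ S : Finset V, S.card < k → (G.induce ((S : Set V)ᶜ)).Connected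

/-- There is a cycle `(a, b, c, d)` whose removal leaves a disconnected graph. -/
def HasSeparatingFourCycle (G : SimpleGraph V) : Prop :=
  ∃ a b c d : V, a ≠ c ∧ b ≠ d ∧ G.Adj a b ∧ G.Adj b c ∧ G.Adj c d ∧ G.Adj d a ∧
    ¬ (G.induce (({a, b, c, d} : Set V)ᶜ)).Preconnected

end Connectivity

section Reduction

/-- The extended wheel graph `XW_{2k}`: a cycle of length `2k` with all edges between vertices at
distance one or two on the cycle, and two non-adjacent poles adjacent to all cycle vertices. -/
def extendedWheel (k : ℕ) : SimpleGraph (ZMod (2 * k) ⊕ Fin 2) :=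
  SimpleGraph.fromRel fun a b => match a, b with
    | Sum.inl i, Sum.inl j => j = i + 1 ∨ j = i + 2
    | Sum.inl _, Sum.inr _ => True
    | Sum.inr _, _ => False

def IsExtendedWheel {V : Type u} (G : SimpleGraph V) : Prop :=
  ∃ k : ℕ, 3 ≤ k ∧ Nonempty (G ≃g extendedWheel k)

variable {V : Type u}

/-- An occurrence of the crossed star `CS` in `G`: a vertex `x` of degree six whose neighbours
`x₁, …, x₆` form the hexagon `(x₁, …, x₆)` together with the triangle `x₁, x₃, x₅`,
so that the three kites `(x, x₁, x₂, x₃)`, `(x, x₃, x₄, x₅)`, `(x, x₅, x₆, x₁)` meet at `x`.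
There may be further edges between the neighbours of `x`. -/
structure CrossedStar (G : SimpleGraph V) where
  (x x₁ x₂ x₃ x₄ x₅ x₆ : V)
  distinct : [x₁, x₂, x₃, x₄, x₅, x₆].Nodup
  neighbors : G.neighborSet x = {x₁, x₂, x₃, x₄, x₅, x₆}
  adj₁₂ : G.Adj x₁ x₂
  adj₂₃ : G.Adj x₂ x₃
  adj₃₄ : G.Adj x₃ x₄
  adj₄₅ : G.Adj x₄ x₅
  adj₅₆ : G.Adj x₅ x₆
  adj₆₁ : G.Adj x₆ x₁
  adj₁₃ : G.Adj x₁ x₃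
  adj₃₅ : G.Adj x₃ x₅
  adj₅₁ : G.Adj x₅ x₁

/-- The reduction `SR(x ↦ x₄)` is feasible if there is no blocking edge. (The other two targets
`x₂` and `x₆` are covered by rotating the labels.) -/
def CrossedStar.Feasible {G : SimpleGraph V} (M : CrossedStar G) : Prop :=
  ¬ G.Adj M.x₂ M.x₄ ∧ ¬ G.Adj M.x₆ M.x₄ ∧ ¬ G.Adj M.x₁ M.x₄

/-- The result of `SR(x ↦ x₄)`: the vertex `x` is removed and merged with `x₄`, so that
the three kites at `x` are replaced by the two adjacent kites `(x₁, x₂, x₃, x₄)` and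
`(x₁, x₄, x₅, x₆)`. The edge `x₃x₅` disappears with the kite `(x, x₃, x₄, x₅)`. -/
def CrossedStar.reduct {G : SimpleGraph V} (M : CrossedStar G) :
    SimpleGraph (({M.x} : Set V)ᶜ : Set V) :=
  (G.deleteEdges {s(M.x₃, M.x₅)} ⊔
    SimpleGraph.fromEdgeSet {s(M.x₄, M.x₁), s(M.x₄, M.x₂), s(M.x₄, M.x₆)}).induce ({M.x}ᶜ)

/-- `G → G'` by one feasible `SR`-reduction, up to isomorphism. -/
def SRStep {W : Type v} (G : SimpleGraph V) (G' : SimpleGraph W) : Prop :=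
  ∃ M : CrossedStar G, M.Feasible ∧ Nonempty (M.reduct ≃g G')

/-- `G →* H` by a finite sequence of feasible `SR`-reductions. -/
inductive SRReducesTo (G : SimpleGraph V) : ∀ {W : Type u}, SimpleGraph W → Prop
  | refl : SRReducesTo G G
  | step {W W' : Type u} {H : SimpleGraph W} {H' : SimpleGraph W'} :
      SRReducesTo G H → SRStep H H' → SRReducesTo G H'

end Reduction

end OptimalOnePlanar

/-! For (2), a separating 4-cycle is weakened to a set of at most four vertices separating two
nonempty sets, and this weaker property is carried through all reductions. Optimality enters only
through one combinatorial consequence. Euler's formula for the planarization and the `4n - 8` edges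
force every face to be a triangle with exactly one crossing (`IsPlanarRotation.triangles`). Hence
the edges are the sides and diagonals of quadrilaterals, each side shared by two of them and each
diagonal lying in one (`IsOptimalOnePlanar.hasKiteCover`).

Walking around a vertex of such a kite cover shows that a non-isolated vertex has at least six
neighbours (`IsKiteCover.exists_adj_notMem`). A feasible reduction turns the three kites at `x` into
two and so keeps a kite cover (`HasKiteCover.reduct`); no drawing has to be followed. It also keeps
a small cut, since it acts like merging `x` into `x₄`, and the degree bound prevents either side of
the cut from vanishing (`HasSmallCut.reduct`). An extended wheel has no small cut
(`not_hasSmallCut_extendedWheel`).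

For (1), an explicit graph on 13 vertices reduces to one on 12 vertices that is cut by four
vertices. A finite table of quadrilaterals and of their gluing, with two more vertices than
quadrilaterals, yields a drawing on the sphere (`IsKiteMap.isOptimalOnePlanar`). The 5-connectivity
follows by enlarging the relation "not separable by fewer than five vertices": it contains the
adjacent pairs and all pairs with five common partners (`FiveLinked.extend`). -/

namespace OptimalOnePlanar

/-! ### Kite covers and the neighbourhood of a vertex in them. -/

section KiteCover

variable {V : Type u} {W : Type v}

/-- The sides of a quadrilateral. -/
def sides : V × V × V × V → Multiset (Sym2 V)
  | (a, b, c, d) => {s(a, b)} + {s(b, c)} + {s(c, d)} + {s(d, a)}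

/-- The diagonals of a quadrilateral. -/
def diagonals : V × V × V × V → Multiset (Sym2 V)
  | (a, b, c, d) => {s(a, c)} + {s(b, d)}

/-- The edges of `G` are the sides and the diagonals of the quadrilaterals in `P`, where each side
belongs to two quadrilaterals, each diagonal to one, and no edge is a side and a diagonal. -/
structure IsKiteCover (G : SimpleGraph V) (P : Multiset (V × V × V × V))
    (S : Multiset (Sym2 V)) : Prop where
  sides_eq : P.bind sides = 2 • S
  nodup : (S + P.bind diagonals).Nodup
  mem_iff : ∀ e, e ∈ S + P.bind diagonals ↔ e ∈ G.edgeSet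

def HasKiteCover (G : SimpleGraph V) : Prop := ∃ P S, IsKiteCover G P S

theorem sides_rotate (a b c d : V) : sides (b, c, d, a) = sides (a, b, c, d) := by
  simp only [sides]; abel

theorem diagonals_rotate (a b c d : V) : diagonals (b, c, d, a) = diagonals (a, b, c, d) := by
  simp only [diagonals, Sym2.eq_swap (a := c) (b := a)]; abel

theorem sides_reflect (a b c d : V) : sides (b, a, d, c) = sides (a, b, c, d) := by
  simp only [sides, Sym2.eq_swap (a := b) (b := a), Sym2.eq_swap (a := a) (b := d),
    Sym2.eq_swap (a := d) (b := c), Sym2.eq_swap (a := c) (b := b)]; abel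

theorem diagonals_reflect (a b c d : V) : diagonals (b, a, d, c) = diagonals (a, b, c, d) := by
  simp only [diagonals]; abel

theorem mem_sides {e : Sym2 V} {a b c d : V} :
    e ∈ sides (a, b, c, d) ↔ e = s(a, b) ∨ e = s(b, c) ∨ e = s(c, d) ∨ e = s(d, a) := by
  simp [sides]

theorem mem_diagonals {e : Sym2 V} {a b c d : V} :
    e ∈ diagonals (a, b, c, d) ↔ e = s(a, c) ∨ e = s(b, d) := by
  simp [diagonals]

/-- A quadrilateral can be relabelled so that it starts with a given oriented side. -/
theorem exists_relabel_of_mem_sides {q : V × V × V × V} {v w : V} (h : s(v, w) ∈ sides q) :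
    ∃ c d, sides (v, w, c, d) = sides q ∧ diagonals (v, w, c, d) = diagonals q := by
  have key : ∀ q : V × V × V × V, s(v, w) = s(q.1, q.2.1) →
      ∃ c d, sides (v, w, c, d) = sides q ∧ diagonals (v, w, c, d) = diagonals q := by
    rintro ⟨a, b, c, d⟩ h
    rcases Sym2.eq_iff.1 h with ⟨rfl, rfl⟩ | ⟨rfl, rfl⟩
    · exact ⟨_, _, rfl, rfl⟩
    · exact ⟨_, _, sides_reflect _ _ _ _, diagonals_reflect _ _ _ _⟩
  obtain ⟨a, b, c, d⟩ := q
  rcases mem_sides.1 h with h | h | h | h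
  · exact key _ h
  · simpa only [sides_rotate, diagonals_rotate] using key (b, c, d, a) h
  · simpa only [sides_rotate, diagonals_rotate] using key (c, d, a, b) h
  · simpa only [sides_rotate, diagonals_rotate] using key (d, a, b, c) h

/-- A quadrilateral can be relabelled so that it starts with an end of a given diagonal. -/
theorem exists_relabel_of_mem_diagonals {q : V × V × V × V} {v w : V}
    (h : s(v, w) ∈ diagonals q) :
    ∃ b d, sides (v, b, w, d) = sides q ∧ diagonals (v, b, w, d) = diagonals q := by
  have key : ∀ q : V × V × V × V, s(v, w) = s(q.1, q.2.2.1) →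
      ∃ b d, sides (v, b, w, d) = sides q ∧ diagonals (v, b, w, d) = diagonals q := by
    rintro ⟨a, b, c, d⟩ h
    rcases Sym2.eq_iff.1 h with ⟨rfl, rfl⟩ | ⟨rfl, rfl⟩
    · exact ⟨_, _, rfl, rfl⟩
    · exact ⟨d, b, (sides_rotate b v d w).trans (sides_rotate w b v d),
        (diagonals_rotate b v d w).trans (diagonals_rotate w b v d)⟩
  obtain ⟨a, b, c, d⟩ := q
  rcases mem_diagonals.1 h with h | h
  · exact key _ h
  · simpa only [sides_rotate, diagonals_rotate] using key (b, c, d, a) h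

variable {G : SimpleGraph V} {P : Multiset (V × V × V × V)} {S : Multiset (Sym2 V)}

namespace IsKiteCover

theorem relabel {q r : V × V × V × V} (hK : IsKiteCover G (q ::ₘ P) S)
    (hs : sides r = sides q) (hd : diagonals r = diagonals q) : IsKiteCover G (r ::ₘ P) S := by
  obtain ⟨h₁, h₂, h₃⟩ := hK
  simp only [Multiset.cons_bind] at h₁ h₂ h₃
  constructor <;> simpa only [Multiset.cons_bind, hs, hd]

theorem adj_of_mem_diagonals (hK : IsKiteCover G P S) {q} (hq : q ∈ P) {v w : V}
    (h : s(v, w) ∈ diagonals q) : G.Adj v w :=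
  (hK.mem_iff _).1 (Multiset.mem_add.2 (Or.inr (Multiset.mem_bind.2 ⟨q, hq, h⟩)))

theorem mem_of_mem_sides (hK : IsKiteCover G P S) {q} (hq : q ∈ P) {e : Sym2 V}
    (h : e ∈ sides q) : e ∈ S := by
  have : e ∈ P.bind sides := Multiset.mem_bind.2 ⟨q, hq, h⟩
  rw [hK.sides_eq] at this
  exact Multiset.mem_of_mem_nsmul this

theorem adj_of_mem_sides (hK : IsKiteCover G P S) {q} (hq : q ∈ P) {v w : V}
    (h : s(v, w) ∈ sides q) : G.Adj v w :=
  (hK.mem_iff _).1 (Multiset.mem_add.2 (Or.inl (hK.mem_of_mem_sides hq h)))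

theorem side_ne_diagonal (hK : IsKiteCover G P S) {q r} (hq : q ∈ P) (hr : r ∈ P) {e f : Sym2 V}
    (he : e ∈ sides q) (hf : f ∈ diagonals r) : e ≠ f := by
  rintro rfl
  exact Multiset.disjoint_left.1 (Multiset.nodup_add.1 hK.nodup).2.2 (hK.mem_of_mem_sides hq he)
    (Multiset.mem_bind.2 ⟨r, hr, hf⟩)

theorem diagonal_ne (hK : IsKiteCover G P S) {q r} (h : q ::ₘ {r} ≤ P) {e f : Sym2 V}
    (he : e ∈ diagonals q) (hf : f ∈ diagonals r) : e ≠ f := by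
  rintro rfl
  obtain ⟨R, rfl⟩ := Multiset.le_iff_exists_add.1 h
  have := (Multiset.nodup_add.1 hK.nodup).2.1
  simp only [Multiset.cons_add, Multiset.cons_bind, Multiset.singleton_add,
    Multiset.nodup_add, Multiset.disjoint_left, Multiset.mem_add] at this
  exact this.2.2 he (Or.inl hf)

theorem adj_of_mem (hK : IsKiteCover G P S) {a b c d : V} (h : (a, b, c, d) ∈ P) :
    G.Adj a b ∧ G.Adj b c ∧ G.Adj c d ∧ G.Adj d a ∧ G.Adj a c ∧ G.Adj b d :=
  ⟨hK.adj_of_mem_sides h (mem_sides.2 (by simp)), hK.adj_of_mem_sides h (mem_sides.2 (by simp)),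
    hK.adj_of_mem_sides h (mem_sides.2 (by simp)), hK.adj_of_mem_sides h (mem_sides.2 (by simp)),
    hK.adj_of_mem_diagonals h (mem_diagonals.2 (by simp)),
    hK.adj_of_mem_diagonals h (mem_diagonals.2 (by simp))⟩

open Classical in
theorem even_count_sides (hK : IsKiteCover G P S) (e : Sym2 V) :
    Even ((P.bind sides).count e) := by
  rw [hK.sides_eq, Multiset.count_nsmul]
  exact even_two_mul _

/-- The quadrilateral on the other side of `vw`. -/
theorem exists_next {q : V × V × V × V} {Q R : Multiset (V × V × V × V)} {v w : V}
    (hK : IsKiteCover G (q ::ₘ (Q + R)) S) (hw : s(v, w) ∈ sides q)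
    (hQ : ∀ r ∈ Q, s(v, w) ∉ sides r) :
    ∃ c d R', IsKiteCover G (q ::ₘ (Q + ((v, w, c, d) ::ₘ R'))) S := by
  classical
  have h0 : (Q.bind sides).count s(v, w) = 0 := by
    rw [Multiset.count_eq_zero, Multiset.mem_bind]
    rintro ⟨r, hr, h⟩
    exact hQ r hr h
  have h1 : (sides q).count s(v, w) = 1 := by
    obtain ⟨c, d, hs, hd⟩ := exists_relabel_of_mem_sides hw
    obtain ⟨h₁, h₂, h₃, h₄, h₅, h₆⟩ := (hK.relabel hs hd).adj_of_mem (Multiset.mem_cons_self _ _)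
    rw [← hs]
    have e1 : s(v, w) ≠ s(w, c) := by simp [h₁.ne, h₅.ne]
    have e2 : s(v, w) ≠ s(c, d) := by simp [h₄.ne', h₅.ne]
    have e3 : s(v, w) ≠ s(d, v) := by simp [h₄.ne', h₆.ne]
    simp [sides, e1, e2, e3]
  -- One occurrence in `q` and none in `Q` make an odd number, so `R` must contribute another.
  have h2 := hK.even_count_sides s(v, w)
  rw [Multiset.cons_bind, Multiset.add_bind, Multiset.count_add, Multiset.count_add, h0, h1] at h2
  have h3 : s(v, w) ∈ R.bind sides := by
    rw [← Multiset.count_pos, Nat.pos_iff_ne_zero]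
    intro h
    rw [h] at h2
    exact absurd h2 (by decide)
  obtain ⟨r, hr, hrs⟩ := Multiset.mem_bind.1 h3
  obtain ⟨R', rfl⟩ := Multiset.exists_cons_of_mem hr
  obtain ⟨c, d, hs, hd⟩ := exists_relabel_of_mem_sides hrs
  refine ⟨c, d, R', ?_⟩
  rw [Multiset.add_cons, Multiset.cons_swap] at hK ⊢
  exact hK.relabel hs hd

/-- Three consecutive quadrilaterals at a vertex have six distinct neighbours of the vertex. -/
theorem exists_three {v b₀ c₀ b₁ : V} {R : Multiset (V × V × V × V)}
    (hK : IsKiteCover G ((v, b₀, c₀, b₁) ::ₘ R) S) :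
    ∃ c₁ b₂ c₂ b₃ R', IsKiteCover G
        ((v, b₀, c₀, b₁) ::ₘ (v, b₁, c₁, b₂) ::ₘ (v, b₂, c₂, b₃) ::ₘ R') S ∧
      [b₀, c₀, b₁, c₁, b₂, c₂].Nodup ∧ b₃ ∉ [c₀, b₁, c₁, b₂, c₂] := by
  obtain ⟨c₁, b₂, R₁, hK₁⟩ := exists_next (Q := 0) (v := v) (w := b₁)
    (by simpa using hK) (mem_sides.2 (by simp [Sym2.eq_swap])) (by simp)
  rw [zero_add] at hK₁
  -- Otherwise `b₀b₁` would be a diagonal of both quadrilaterals. Hence `vb₂` is not a side of the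
  -- first one, and the walk around `v` goes on to a third.
  have h₂₀ : b₂ ≠ b₀ := by
    rintro rfl
    refine hK₁.diagonal_ne (Multiset.cons_le_cons _ (Multiset.singleton_le.2
      (Multiset.mem_cons_self _ _))) (mem_diagonals.2 (Or.inr rfl))
      (mem_diagonals.2 (Or.inr rfl)) ?_
    exact Sym2.eq_swap
  have a₀ := hK₁.adj_of_mem (a := v) (b := b₀) (c := c₀) (d := b₁) (by simp)
  have a₁ := hK₁.adj_of_mem (a := v) (b := b₁) (c := c₁) (d := b₂) (by simp)
  obtain ⟨c₂, b₃, R₂, hK₂⟩ := exists_next (Q := {(v, b₀, c₀, b₁)}) (v := v) (w := b₂)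
    (R := R₁) (q := (v, b₁, c₁, b₂)) (S := S) (G := G)
    (by rw [Multiset.cons_swap] at hK₁; simpa using hK₁)
    (mem_sides.2 (by simp [Sym2.eq_swap])) (by
      simp only [Multiset.mem_singleton, forall_eq, mem_sides, Sym2.eq_iff]
      have := a₀.1.ne
      have := a₀.2.2.2.1.ne
      have := a₀.2.2.2.2.1.ne
      have := a₁.2.2.2.2.2.ne
      tauto)
  rw [Multiset.singleton_add, Multiset.cons_swap] at hK₂
  have h₃₁ : b₃ ≠ b₁ := by
    rintro rfl
    refine hK₂.diagonal_ne (q := (v, b₃, c₁, b₂)) (r := (v, b₂, c₂, b₃)) ?_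
      (mem_diagonals.2 (Or.inr rfl)) (mem_diagonals.2 (Or.inr rfl)) Sym2.eq_swap
    exact (Multiset.cons_le_cons _ (Multiset.singleton_le.2
      (Multiset.mem_cons_self _ _))).trans (Multiset.le_cons_self _ _)
  have a₂ := hK₂.adj_of_mem (a := v) (b := b₂) (c := c₂) (d := b₃) (by simp)
  refine ⟨c₁, b₂, c₂, b₃, R₂, hK₂, ?_⟩
  -- Each `b` is joined to `v` by a side and each `c` by a diagonal. Only `b₃ = b₀` stays possible,
  -- which is the case of degree six.
  have hbc : ∀ b ∈ [b₀, b₁, b₂, b₃], ∀ c ∈ [c₀, c₁, c₂], b ≠ c := by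
    intro b hb c hc hbc
    have h1 : ∃ q ∈ ((v, b₀, c₀, b₁) ::ₘ (v, b₁, c₁, b₂) ::ₘ (v, b₂, c₂, b₃) ::ₘ R₂),
        s(v, b) ∈ sides q := by
      simp only [List.mem_cons, List.not_mem_nil, or_false] at hb
      rcases hb with rfl | rfl | rfl | rfl
      · exact ⟨(v, b, c₀, b₁), by simp, mem_sides.2 (Or.inl rfl)⟩
      · exact ⟨(v, b, c₁, b₂), by simp, mem_sides.2 (Or.inl rfl)⟩
      · exact ⟨(v, b, c₂, b₃), by simp, mem_sides.2 (Or.inl rfl)⟩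
      · exact ⟨(v, b₂, c₂, b), by simp, mem_sides.2 (by simp [Sym2.eq_swap])⟩
    have h2 : ∃ q ∈ ((v, b₀, c₀, b₁) ::ₘ (v, b₁, c₁, b₂) ::ₘ (v, b₂, c₂, b₃) ::ₘ R₂),
        s(v, c) ∈ diagonals q := by
      simp only [List.mem_cons, List.not_mem_nil, or_false] at hc
      rcases hc with rfl | rfl | rfl
      · exact ⟨(v, b₀, c, b₁), by simp, mem_diagonals.2 (Or.inl rfl)⟩
      · exact ⟨(v, b₁, c, b₂), by simp, mem_diagonals.2 (Or.inl rfl)⟩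
      · exact ⟨(v, b₂, c, b₃), by simp, mem_diagonals.2 (Or.inl rfl)⟩
    obtain ⟨q, hq, hqs⟩ := h1
    obtain ⟨r, hr, hrd⟩ := h2
    exact hK₂.side_ne_diagonal hq hr hqs hrd (by rw [hbc])
  have d₀₁ : c₀ ≠ c₁ := by
    rintro rfl
    exact hK₂.diagonal_ne (q := (v, b₀, c₀, b₁)) (r := (v, b₁, c₀, b₂))
      (Multiset.cons_le_cons _ (Multiset.singleton_le.2 (Multiset.mem_cons_self _ _)))
      (mem_diagonals.2 (Or.inl rfl)) (mem_diagonals.2 (Or.inl rfl)) rfl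
  have d₀₂ : c₀ ≠ c₂ := by
    rintro rfl
    exact hK₂.diagonal_ne (q := (v, b₀, c₀, b₁)) (r := (v, b₂, c₀, b₃))
      (Multiset.cons_le_cons _ (Multiset.singleton_le.2 (by simp)))
      (mem_diagonals.2 (Or.inl rfl)) (mem_diagonals.2 (Or.inl rfl)) rfl
  have d₁₂ : c₁ ≠ c₂ := by
    rintro rfl
    exact hK₂.diagonal_ne (q := (v, b₁, c₁, b₂)) (r := (v, b₂, c₁, b₃))
      ((Multiset.cons_le_cons _ (Multiset.singleton_le.2
        (Multiset.mem_cons_self _ _))).trans (Multiset.le_cons_self _ _))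
      (mem_diagonals.2 (Or.inl rfl)) (mem_diagonals.2 (Or.inl rfl)) rfl
  have e₀ := a₀.2.2.2.2.2.ne
  have e₁ := a₁.2.2.2.2.2.ne
  have e₂ := a₂.2.2.2.2.2.ne
  simp only [List.mem_cons, List.not_mem_nil, or_false, forall_eq_or_imp, forall_eq] at hbc
  simp only [List.nodup_cons, List.mem_cons, List.not_mem_nil, or_false, not_or,
    List.nodup_nil, not_false_eq_true, and_true]
  grind

/-- A vertex that is not isolated is the first vertex of a quadrilateral. -/
theorem exists_cons_of_adj (hK : IsKiteCover G P S) {v w : V} (h : G.Adj v w) :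
    ∃ b c d R, IsKiteCover G ((v, b, c, d) ::ₘ R) S ∧ (w = b ∨ w = c) := by
  rcases Multiset.mem_add.1 ((hK.mem_iff s(v, w)).2 h) with h | h
  · have : s(v, w) ∈ P.bind sides := by
      rw [hK.sides_eq, two_nsmul]
      exact Multiset.mem_add.2 (Or.inl h)
    obtain ⟨q, hq, hs⟩ := Multiset.mem_bind.1 this
    obtain ⟨R, rfl⟩ := Multiset.exists_cons_of_mem hq
    obtain ⟨c, d, h₁, h₂⟩ := exists_relabel_of_mem_sides hs
    exact ⟨w, c, d, R, hK.relabel h₁ h₂, Or.inl rfl⟩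
  · obtain ⟨q, hq, hs⟩ := Multiset.mem_bind.1 h
    obtain ⟨R, rfl⟩ := Multiset.exists_cons_of_mem hq
    obtain ⟨b, d, h₁, h₂⟩ := exists_relabel_of_mem_diagonals hs
    exact ⟨b, w, d, R, hK.relabel h₁ h₂, Or.inr rfl⟩

/-- The neighbours of a vertex that is not isolated cannot be covered by five vertices. -/
theorem exists_adj_notMem (hK : IsKiteCover G P S) {v w : V} (h : G.Adj v w) (T : Finset V)
    (hT : T.card < 6) : ∃ u, G.Adj v u ∧ u ∉ T := by
  classical
  obtain ⟨b₀, c₀, b₁, R, hK, -⟩ := hK.exists_cons_of_adj h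
  obtain ⟨c₁, b₂, c₂, b₃, R', hK, hn, -⟩ := hK.exists_three
  by_contra! hcon
  have a₀ := hK.adj_of_mem (a := v) (b := b₀) (c := c₀) (d := b₁) (by simp)
  have a₁ := hK.adj_of_mem (a := v) (b := b₁) (c := c₁) (d := b₂) (by simp)
  have a₂ := hK.adj_of_mem (a := v) (b := b₂) (c := c₂) (d := b₃) (by simp)
  have h1 : [b₀, c₀, b₁, c₁, b₂, c₂].toFinset ⊆ T := by
    intro u hu
    simp only [List.mem_toFinset, List.mem_cons, List.not_mem_nil, or_false] at hu
    apply hcon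
    rcases hu with rfl | rfl | rfl | rfl | rfl | rfl
    exacts [a₀.1, a₀.2.2.2.2.1, a₁.1, a₁.2.2.2.2.1, a₂.1, a₂.2.2.2.2.1]
  have h2 := Finset.card_le_card h1
  rw [List.toFinset_card_of_nodup hn] at h2
  simp at h2
  omega

/-- The quadrilaterals at a vertex of degree six. -/
theorem exists_star {x b₀ c₀ b₁ : V} {R : Multiset (V × V × V × V)}
    (hK : IsKiteCover G ((x, b₀, c₀, b₁) ::ₘ R) S) (hx : (G.neighborSet x).ncard = 6) :
    ∃ c₁ b₂ c₂ R', IsKiteCover G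
        ((x, b₀, c₀, b₁) ::ₘ (x, b₁, c₁, b₂) ::ₘ (x, b₂, c₂, b₀) ::ₘ R') S ∧
      [b₀, c₀, b₁, c₁, b₂, c₂].Nodup ∧ G.neighborSet x = {b₀, c₀, b₁, c₁, b₂, c₂} := by
  classical
  obtain ⟨c₁, b₂, c₂, b₃, R', hK, hn, hb⟩ := hK.exists_three
  have a₀ := hK.adj_of_mem (a := x) (b := b₀) (c := c₀) (d := b₁) (by simp)
  have a₁ := hK.adj_of_mem (a := x) (b := b₁) (c := c₁) (d := b₂) (by simp)
  have a₂ := hK.adj_of_mem (a := x) (b := b₂) (c := c₂) (d := b₃) (by simp)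
  have h1 : (([b₀, c₀, b₁, c₁, b₂, c₂].toFinset : Finset V) : Set V) ⊆ G.neighborSet x := by
    intro u hu
    simp only [List.coe_toFinset, Set.mem_ofPred_eq, List.mem_cons, List.not_mem_nil,
      or_false] at hu
    rcases hu with rfl | rfl | rfl | rfl | rfl | rfl
    exacts [a₀.1, a₀.2.2.2.2.1, a₁.1, a₁.2.2.2.2.1, a₂.1, a₂.2.2.2.2.1]
  have h2 := Set.eq_of_subset_of_ncard_le h1 (by
    rw [hx, Set.ncard_coe_finset, List.toFinset_card_of_nodup hn]; simp)
    (Set.finite_of_ncard_ne_zero (by omega))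
  have h3 : b₃ ∈ G.neighborSet x := a₂.2.2.2.1.symm
  rw [← h2] at h3
  simp only [List.coe_toFinset, Set.mem_ofPred_eq, List.mem_cons] at h3
  simp only [List.mem_cons, not_or] at hb
  -- The six neighbours found are all there are, so the walk around `x` closes after three
  -- quadrilaterals.
  obtain rfl : b₃ = b₀ := by tauto
  refine ⟨c₁, b₂, c₂, R', hK, hn, ?_⟩
  rw [← h2]
  ext u
  simp

end IsKiteCover

/-- A reduced graph lives on a subtype; its cover is written with the old vertices and pulled back
here. Every corner has an incident edge, hence lies in the range of `f`. -/
theorem HasKiteCover.of_map {H : SimpleGraph W} (f : W ↪ V) (h : HasKiteCover (H.map f)) :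
    HasKiteCover H := by
  obtain ⟨P, S, hK⟩ := h
  let g : W × W × W × W → V × V × V × V := fun q => (f q.1, f q.2.1, f q.2.2.1, f q.2.2.2)
  have hr : ∀ u w, (H.map f).Adj u w → u ∈ Set.range f := by
    rintro u w ⟨-, a, b, -, rfl, rfl⟩
    exact ⟨a, rfl⟩
  have hP : ∀ q ∈ P, q ∈ Set.range g := by
    rintro ⟨a, b, c, d⟩ hq
    obtain ⟨h₁, h₂, h₃, h₄, -, -⟩ := hK.adj_of_mem hq
    obtain ⟨a, rfl⟩ := hr _ _ h₁
    obtain ⟨b, rfl⟩ := hr _ _ h₂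
    obtain ⟨c, rfl⟩ := hr _ _ h₃
    obtain ⟨d, rfl⟩ := hr _ _ h₄
    exact ⟨(a, b, c, d), rfl⟩
  have hS : ∀ e ∈ S, e ∈ Set.range (Sym2.map f) := by
    intro e he
    have := (hK.mem_iff e).1 (Multiset.mem_add.2 (Or.inl he))
    rw [SimpleGraph.edgeSet_map] at this
    obtain ⟨e', -, rfl⟩ := this
    exact ⟨e', rfl⟩
  have lift : ∀ {α β : Type _} (k : α → β) (M : Multiset β), (∀ m ∈ M, m ∈ Set.range k) →
      ∃ N : Multiset α, N.map k = M := by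
    intro α β k M
    induction M using Multiset.induction_on with
    | empty => exact fun _ => ⟨0, rfl⟩
    | cons m M ih =>
      intro h
      obtain ⟨N, rfl⟩ := ih fun m hm => h m (Multiset.mem_cons_of_mem hm)
      obtain ⟨n, rfl⟩ := h m (Multiset.mem_cons_self _ _)
      exact ⟨n ::ₘ N, by simp⟩
  obtain ⟨P, rfl⟩ := lift g P hP
  obtain ⟨S, rfl⟩ := lift (Sym2.map f) S hS
  have hs : (P.map g).bind sides = (P.bind sides).map (Sym2.map f) := by
    rw [Multiset.bind_map, Multiset.map_bind]
    exact Multiset.bind_congr fun q _ => by simp [g, sides]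
  have hd : (P.map g).bind diagonals = (P.bind diagonals).map (Sym2.map f) := by
    rw [Multiset.bind_map, Multiset.map_bind]
    exact Multiset.bind_congr fun q _ => by simp [g, diagonals]
  have hi : Function.Injective (Sym2.map f) := Sym2.map.injective f.injective
  refine ⟨P, S, ?_, ?_, fun e => ?_⟩
  · apply Multiset.map_injective hi
    rw [← hs, hK.sides_eq, Multiset.map_nsmul]
  · have := hK.nodup
    rw [hd, ← Multiset.map_add] at this
    exact Multiset.Nodup.of_map _ this
  · have := hK.mem_iff (Sym2.map f e)
    rw [hd, ← Multiset.map_add, Multiset.mem_map_of_injective hi] at this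
    rw [this, SimpleGraph.edgeSet_map]
    exact (f.sym2Map.injective.mem_set_image)

theorem HasKiteCover.of_iso {H : SimpleGraph W} (e : G ≃g H) (h : HasKiteCover G) :
    HasKiteCover H := by
  refine HasKiteCover.of_map (e.symm : W ≃ V).toEmbedding ?_
  have : H.map (e.symm : W ≃ V).toEmbedding = G := by
    ext a b
    simp only [SimpleGraph.map_adj]
    constructor
    · rintro ⟨a, b, h, rfl, rfl⟩
      exact (e.symm.map_rel_iff).2 h
    · intro h
      exact ⟨e a, e b, e.map_rel_iff.2 h, e.symm_apply_apply a, e.symm_apply_apply b⟩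
  rwa [this]

end KiteCover

/-! ### Kite covers survive feasible reductions. -/

section Reduction

variable {V : Type u} {W : Type v} {G : SimpleGraph V}

namespace CrossedStar

variable (M : CrossedStar G)

theorem adj_x_iff {v : V} : G.Adj M.x v ↔
    v = M.x₁ ∨ v = M.x₂ ∨ v = M.x₃ ∨ v = M.x₄ ∨ v = M.x₅ ∨ v = M.x₆ := by
  rw [← SimpleGraph.mem_neighborSet, M.neighbors]
  simp

theorem ncard_neighborSet : (G.neighborSet M.x).ncard = 6 := by
  classical
  have : G.neighborSet M.x = ([M.x₁, M.x₂, M.x₃, M.x₄, M.x₅, M.x₆].toFinset : Finset V) := by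
    rw [M.neighbors]
    ext v
    simp
  rw [this, Set.ncard_coe_finset, List.toFinset_card_of_nodup M.distinct]
  simp

theorem reduct_adj_iff {a b : (({M.x} : Set V)ᶜ : Set V)} : M.reduct.Adj a b ↔
    (G.Adj a b ∧ s(a.1, b.1) ≠ s(M.x₃, M.x₅)) ∨ (s(a.1, b.1) = s(M.x₄, M.x₁) ∨
      s(a.1, b.1) = s(M.x₄, M.x₂) ∨ s(a.1, b.1) = s(M.x₄, M.x₆)) ∧ a.1 ≠ b.1 := by
  simp only [reduct, SimpleGraph.comap_adj, SimpleGraph.sup_adj, SimpleGraph.deleteEdges_adj,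
    SimpleGraph.fromEdgeSet_adj, Set.mem_insert_iff, Set.mem_singleton_iff,
    Function.Embedding.subtype_apply, ne_eq]

end CrossedStar

/-- The labelling of a crossed star with a feasible reduction agrees with the three
quadrilaterals at its centre, up to the order of `x₁, x₂, x₆` and of `x₃, x₅`. -/
theorem HasKiteCover.exists_star_of_feasible (h : HasKiteCover G) (M : CrossedStar G)
    (hM : M.Feasible) : ∃ b₀ b₁ c₁ b₂ c₂ R S, IsKiteCover G ((M.x, b₀, M.x₄, b₁) ::ₘ
        (M.x, b₁, c₁, b₂) ::ₘ (M.x, b₂, c₂, b₀) ::ₘ R) S ∧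
      [b₀, M.x₄, b₁, c₁, b₂, c₂].Nodup ∧
      G.neighborSet M.x = {b₀, M.x₄, b₁, c₁, b₂, c₂} ∧ s(M.x₃, M.x₅) = s(b₀, b₁) ∧
      ∀ v, (v = M.x₁ ∨ v = M.x₂ ∨ v = M.x₆) ↔ (v = b₂ ∨ v = c₂ ∨ v = c₁) := by
  classical
  obtain ⟨P, S, hK⟩ := h
  obtain ⟨hM₂, hM₆, hM₁⟩ := hM
  have hdis := M.distinct
  simp only [List.nodup_cons, List.mem_cons, List.not_mem_nil, or_false, not_or,
    List.nodup_nil, not_false_eq_true, and_true] at hdis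
  obtain ⟨b₀, y, b₁, R, hK, hx₄⟩ := hK.exists_cons_of_adj (M.adj_x_iff.2 (by simp) :
    G.Adj M.x M.x₄)
  obtain ⟨c₁, b₂, c₂, R, hK, hn, hN⟩ := hK.exists_star M.ncard_neighborSet
  obtain ⟨a₀₁, a₀₂, a₀₃, a₀₄, a₀₅, a₀₆⟩ := hK.adj_of_mem (a := M.x) (b := b₀) (c := y) (d := b₁)
    (by simp)
  obtain ⟨a₁₁, a₁₂, a₁₃, a₁₄, a₁₅, a₁₆⟩ := hK.adj_of_mem (a := M.x) (b := b₁) (c := c₁) (d := b₂)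
    (by simp)
  obtain ⟨a₂₁, a₂₂, a₂₃, a₂₄, a₂₅, a₂₆⟩ := hK.adj_of_mem (a := M.x) (b := b₂) (c := c₂) (d := b₀)
    (by simp)
  have hN' : ∀ v, (v = b₀ ∨ v = y ∨ v = b₁ ∨ v = c₁ ∨ v = b₂ ∨ v = c₂) ↔
      v = M.x₁ ∨ v = M.x₂ ∨ v = M.x₃ ∨ v = M.x₄ ∨ v = M.x₅ ∨ v = M.x₆ := by
    intro v
    rw [← M.adj_x_iff, ← SimpleGraph.mem_neighborSet, hN]
    simp
  have hn' := hn
  simp only [List.nodup_cons, List.mem_cons, List.not_mem_nil, or_false, not_or,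
    List.nodup_nil, not_false_eq_true, and_true] at hn
  rcases hx₄ with rfl | hy
  -- If `x₄` were joined to `x` by a side, it would be adjacent to every other neighbour of `x`
  -- except `c₁`, and feasibility would force both `x₁` and `x₂` to be `c₁`.
  · exfalso
    have key : ∀ v, ¬ G.Adj v M.x₄ → v ≠ M.x₄ → (v = M.x₁ ∨ v = M.x₂ ∨ v = M.x₆) → v = c₁ := by
      intro v h1 h2 h3
      rcases (hN' v).2 (by tauto) with rfl | rfl | rfl | rfl | rfl | rfl
      · exact absurd rfl h2
      · exact absurd a₀₂.symm h1
      · exact absurd a₀₆.symm h1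
      · rfl
      · exact absurd a₂₆ h1
      · exact absurd a₂₃ h1
    have e1 := key M.x₁ hM₁ (by tauto) (by simp)
    have e2 := key M.x₂ hM₂ (by tauto) (by simp)
    exact hdis.1.1 (e1.trans e2.symm)
  · subst hy
    -- The corners `b₀`, `b₁` are adjacent to `x₄`, and feasibility leaves only `x₃`, `x₅` for them.
    have h₃₅ : s(M.x₃, M.x₅) = s(b₀, b₁) := by
      have key : ∀ v, G.Adj v M.x₄ → (v = b₀ ∨ v = b₁) → v = M.x₃ ∨ v = M.x₅ := by
        intro v h1 h2
        rcases (hN' v).1 (by tauto) with rfl | rfl | rfl | rfl | rfl | rfl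
        · exact absurd h1 hM₁
        · exact absurd h1 hM₂
        · exact Or.inl rfl
        · exact absurd rfl h1.ne
        · exact Or.inr rfl
        · exact absurd h1 hM₆
      have k0 := key b₀ a₀₂ (by simp)
      have k1 := key b₁ a₀₃.symm (by simp)
      have := hn.1.2.1
      rw [Sym2.eq_iff]
      clear hN' hN hK hdis hn hn'
      grind
    have hnew : ∀ v, (v = M.x₁ ∨ v = M.x₂ ∨ v = M.x₆) ↔ (v = b₂ ∨ v = c₂ ∨ v = c₁) := by
      intro v
      have := hN' v
      clear hN' hN hK hn'
      have := Sym2.eq_iff.1 h₃₅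
      grind
    exact ⟨b₀, b₁, c₁, b₂, c₂, R, S, hK, hn', hN, h₃₅, hnew⟩

/-- The edges of the reduced graph, in terms of the three quadrilaterals at the centre. -/
theorem CrossedStar.mem_edgeSet_reduct_map (M : CrossedStar G) {b₀ b₁ b₂ c₁ c₂ : V}
    (hn : M.x₄ ≠ b₂ ∧ M.x₄ ≠ c₂ ∧ M.x₄ ≠ c₁) (h₃₅ : s(M.x₃, M.x₅) = s(b₀, b₁))
    (hnew : ∀ v, (v = M.x₁ ∨ v = M.x₂ ∨ v = M.x₆) ↔ (v = b₂ ∨ v = c₂ ∨ v = c₁)) (e : Sym2 V) :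
    e ∈ (M.reduct.map (Function.Embedding.subtype _)).edgeSet ↔ M.x ∉ e ∧
    ((e ∈ G.edgeSet ∧ e ≠ s(b₀, b₁)) ∨ e = s(M.x₄, b₂) ∨ e = s(M.x₄, c₂) ∨ e = s(M.x₄, c₁)) := by
  have hnew' : ∀ e, (e = s(M.x₄, M.x₁) ∨ e = s(M.x₄, M.x₂) ∨ e = s(M.x₄, M.x₆)) ↔
      (e = s(M.x₄, b₂) ∨ e = s(M.x₄, c₂) ∨ e = s(M.x₄, c₁)) := by
    intro e
    constructor
    · rintro (rfl | rfl | rfl)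
      · rcases (hnew M.x₁).1 (by simp) with h | h | h <;> simp [h]
      · rcases (hnew M.x₂).1 (by simp) with h | h | h <;> simp [h]
      · rcases (hnew M.x₆).1 (by simp) with h | h | h <;> simp [h]
    · rintro (rfl | rfl | rfl)
      · rcases (hnew b₂).2 (by simp) with h | h | h <;> simp [h]
      · rcases (hnew c₂).2 (by simp) with h | h | h <;> simp [h]
      · rcases (hnew c₁).2 (by simp) with h | h | h <;> simp [h]
  induction e using Sym2.ind with | _ a b => ?_
  rw [SimpleGraph.mem_edgeSet, SimpleGraph.map_adj]
  constructor
  · rintro ⟨⟨a, ha⟩, ⟨b, hb⟩, h, rfl, rfl⟩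
    rw [M.reduct_adj_iff] at h
    simp only [hnew', h₃₅] at h
    simp only [Set.mem_compl_iff, Set.mem_singleton_iff] at ha hb
    simp only [Function.Embedding.subtype_apply, Sym2.mem_iff, SimpleGraph.mem_edgeSet]
    refine ⟨by tauto, ?_⟩
    tauto
  · rintro ⟨h1, h2⟩
    simp only [Sym2.mem_iff, not_or, SimpleGraph.mem_edgeSet] at h1 h2
    refine ⟨⟨a, fun h => h1.1 h.symm⟩, ⟨b, fun h => h1.2 h.symm⟩, ?_, rfl, rfl⟩
    rw [M.reduct_adj_iff]
    simp only [hnew', h₃₅]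
    have : a ≠ b := by
      rintro rfl
      rcases h2 with h2 | h2 | h2 | h2
      · exact h2.1.ne rfl
      all_goals
        rw [Sym2.eq_iff] at h2
        rcases h2 with ⟨rfl, h⟩ | ⟨h, rfl⟩
        · simp [h] at hn
        · simp [h] at hn
    tauto
-- With `y = x₄`, the kites `(x, b₀, y, b₁)`, `(x, b₁, c₁, b₂)`, `(x, b₂, c₂, b₀)` are replaced by
-- `(b₂, c₂, b₀, y)` and `(b₂, y, b₁, c₁)`. The new side is `yb₂`, the new diagonals are `yc₁` and
-- `yc₂`; the diagonals `b₁b₂` and `b₂b₀` persist.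
theorem HasKiteCover.reduct (h : HasKiteCover G) (M : CrossedStar G) (hM : M.Feasible) :
    HasKiteCover M.reduct := by
  classical
  obtain ⟨b₀, b₁, c₁, b₂, c₂, R, S, hK, hn, hN, h₃₅, hnew⟩ := h.exists_star_of_feasible M hM
  obtain ⟨hM₂, hM₆, hM₁⟩ := hM
  simp only [List.nodup_cons, List.mem_cons, List.not_mem_nil, or_false, not_or,
    List.nodup_nil, not_false_eq_true, and_true] at hn
  have hedge := M.mem_edgeSet_reduct_map ⟨hn.2.1.2.2.1, hn.2.1.2.2.2, hn.2.1.2.1⟩ h₃₅ hnew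
  clear h h₃₅
  obtain ⟨x, hx⟩ : ∃ x, M.x = x := ⟨_, rfl⟩
  obtain ⟨y, hy⟩ : ∃ y, M.x₄ = y := ⟨_, rfl⟩
  simp only [hx, hy] at hK hn hN hM₁ hM₂ hM₆
  have a₀₅ : G.Adj x y := (hK.adj_of_mem (a := x) (b := b₀) (c := y) (d := b₁)
    (by simp)).2.2.2.2.1
  have a₁₅ : G.Adj x c₁ := (hK.adj_of_mem (a := x) (b := b₁) (c := c₁) (d := b₂)
    (by simp)).2.2.2.2.1
  obtain ⟨a₂₁, -, -, -, a₂₅, -⟩ := hK.adj_of_mem (a := x) (b := b₂) (c := c₂) (d := b₀)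
    (by simp)
  have hx_nbr : ∀ v, G.Adj x v → v = b₀ ∨ v = y ∨ v = b₁ ∨ v = c₁ ∨ v = b₂ ∨ v = c₂ := by
    intro v h
    rw [← SimpleGraph.mem_neighborSet, hN] at h
    simpa using h
  have hna : ∀ v, (v = b₂ ∨ v = c₂ ∨ v = c₁) → ¬ G.Adj y v := by
    intro v hv h
    rcases (hnew v).2 hv with rfl | rfl | rfl
    exacts [hM₁ h.symm, hM₂ h.symm, hM₆ h.symm]
  have m₀ : s(x, b₀) ∈ S := hK.mem_of_mem_sides (Multiset.mem_cons_self _ _)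
    (mem_sides.2 (Or.inl rfl))
  have m₁ : s(x, b₁) ∈ S := hK.mem_of_mem_sides (q := (x, b₁, c₁, b₂)) (by simp)
    (mem_sides.2 (Or.inl rfl))
  have m₂ : s(x, b₂) ∈ S := hK.mem_of_mem_sides (q := (x, b₂, c₂, b₀)) (by simp)
    (mem_sides.2 (Or.inl rfl))
  obtain ⟨S₀, rfl⟩ : ∃ S₀, S = {s(x, b₀)} + {s(x, b₁)} + {s(x, b₂)} + S₀ := by
    rw [← Multiset.le_iff_exists_add]
    have : ({s(x, b₀)} + {s(x, b₁)} + {s(x, b₂)} : Multiset (Sym2 V)).Nodup := by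
      simp only [Multiset.singleton_add, Multiset.cons_add, Multiset.nodup_cons,
        Multiset.mem_cons, Multiset.mem_singleton, Sym2.congr_right, Multiset.nodup_singleton]
      grind
    rw [Multiset.le_iff_subset this]
    intro e he
    simp only [Multiset.mem_add, Multiset.mem_singleton] at he
    rcases he with (rfl | rfl) | rfl <;> assumption
  obtain ⟨k₁, k₂, k₃⟩ := hK
  -- `old` collects the seven edges that disappear, `rest` those that stay.
  obtain ⟨rest, hrest⟩ : ∃ r, r = S₀ + {s(b₁, b₂)} + {s(b₂, b₀)} + R.bind diagonals := ⟨_, rfl⟩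
  obtain ⟨old, hold⟩ : ∃ r : Multiset (Sym2 V), r = {s(x, b₀)} + {s(x, b₁)} + {s(x, b₂)} +
    {s(x, y)} + {s(x, c₁)} + {s(x, c₂)} + {s(b₀, b₁)} := ⟨_, rfl⟩
  have hsplit : ({s(x, b₀)} + {s(x, b₁)} + {s(x, b₂)} + S₀) + Multiset.bind
      ((x, b₀, y, b₁) ::ₘ (x, b₁, c₁, b₂) ::ₘ (x, b₂, c₂, b₀) ::ₘ R) diagonals =
      old + rest := by
    simp only [Multiset.cons_bind, diagonals, hrest, hold]
    abel
  have hsplit' : ({s(b₂, y)} + S₀) + Multiset.bind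
      ((b₂, c₂, b₀, y) ::ₘ (b₂, y, b₁, c₁) ::ₘ R) diagonals =
      {s(y, b₂)} + {s(y, c₂)} + {s(y, c₁)} + rest := by
    simp only [Multiset.cons_bind, diagonals, hrest, Sym2.eq_swap (a := b₂) (b := y),
      Sym2.eq_swap (a := c₂) (b := y), Sym2.eq_swap (a := b₁) (b := b₂)]
    abel
  rw [hsplit] at k₂
  simp only [hsplit] at k₃
  obtain ⟨n₁, n₂, n₃⟩ := Multiset.nodup_add.1 k₂
  have hmem_rest : ∀ e, e ∈ rest ↔ e ∈ G.edgeSet ∧ e ∉ old := by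
    intro e
    rw [← k₃, Multiset.mem_add]
    exact ⟨fun h => ⟨Or.inr h, fun h' => Multiset.disjoint_left.1 n₃ h' h⟩,
      fun h => h.1.resolve_left h.2⟩
  refine HasKiteCover.of_map (Function.Embedding.subtype _)
    ⟨(b₂, c₂, b₀, y) ::ₘ (b₂, y, b₁, c₁) ::ₘ R, {s(b₂, y)} + S₀, ?_, ?_, ?_⟩
  · simp only [Multiset.cons_bind, sides, nsmul_add] at k₁ ⊢
    -- Each `xbᵢ` is a side of two of the three old kites and cancels. The outer hexagon remains,
    -- and the two new kites add `yb₂` twice.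
    have k₁' : (2 • {s(x, b₀)} + 2 • {s(x, b₁)} + 2 • {s(x, b₂)} : Multiset (Sym2 V)) +
        ({s(b₀, y)} + {s(y, b₁)} + {s(b₁, c₁)} + {s(c₁, b₂)} + {s(b₂, c₂)} + {s(c₂, b₀)} +
          R.bind sides) =
        (2 • {s(x, b₀)} + 2 • {s(x, b₁)} + 2 • {s(x, b₂)}) + 2 • S₀ := by
      rw [← k₁, Sym2.eq_swap (a := b₁) (b := x), Sym2.eq_swap (a := b₂) (b := x),
        Sym2.eq_swap (a := b₀) (b := x)]
      abel
    rw [← add_left_cancel k₁', Sym2.eq_swap (a := y) (b := b₂)]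
    abel
  · rw [hsplit']
    -- Feasibility: the three added edges at `y` were not edges before, so no edge is listed twice.
    have hni : ∀ v, (v = b₂ ∨ v = c₂ ∨ v = c₁) → s(y, v) ∉ rest := fun v hv h =>
      hna v hv ((hmem_rest _).1 h).1
    have i1 := hni b₂ (by simp)
    have i2 := hni c₂ (by simp)
    have i3 := hni c₁ (by simp)
    simp only [Multiset.singleton_add, Multiset.cons_add, Multiset.nodup_cons,
      Multiset.mem_cons, Sym2.congr_right]
    grind
  · intro e
    rw [hsplit', hedge, hx, hy]
    simp only [Multiset.mem_add, Multiset.mem_singleton]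
    have hxe : e ∈ G.edgeSet → (e ∈ old ↔ x ∈ e ∨ e = s(b₀, b₁)) := by
      intro he
      simp only [hold, Multiset.mem_add, Multiset.mem_singleton]
      refine or_congr_left ⟨?_, fun hxe => ?_⟩
      · rintro (((((rfl | rfl) | rfl) | rfl) | rfl) | rfl) <;> simp
      · obtain ⟨v, rfl⟩ := Sym2.mem_iff_exists.1 hxe
        rcases hx_nbr v he with rfl | rfl | rfl | rfl | rfl | rfl <;> simp
    have q1 : x ∉ s(y, b₂) := by simp [a₀₅.ne, a₂₁.ne]
    have q2 : x ∉ s(y, c₂) := by simp [a₀₅.ne, a₂₅.ne]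
    have q3 : x ∉ s(y, c₁) := by simp [a₀₅.ne, a₁₅.ne]
    constructor
    · rintro (((rfl | rfl) | rfl) | h)
      · simp [q1]
      · simp [q2]
      · simp [q3]
      · obtain ⟨h1, h2⟩ := (hmem_rest e).1 h
        rw [hxe h1, not_or] at h2
        exact ⟨h2.1, Or.inl ⟨h1, h2.2⟩⟩
    · rintro ⟨h1, ⟨h2, h3⟩ | h | h | h⟩
      · refine Or.inr ((hmem_rest e).2 ⟨h2, ?_⟩)
        rw [hxe h2, not_or]
        exact ⟨h1, h3⟩
      · simp [h]
      · simp [h]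
      · simp [h]

end Reduction

/-! ### Cuts of at most four vertices under reductions and in extended wheels. -/

section SmallCut

variable {V : Type u} {W : Type v} {G : SimpleGraph V}

/-- At most four vertices separate two nonempty sets of vertices. -/
def HasSmallCut (G : SimpleGraph V) : Prop :=
  ∃ (A B : Set V) (T : Finset V), A.Nonempty ∧ B.Nonempty ∧
    (∀ a ∈ A, ∀ b ∈ B, a ≠ b ∧ ¬ G.Adj a b) ∧
    T.card ≤ 4 ∧ ∀ v, v ∈ A ∨ v ∈ B ∨ v ∈ T

theorem HasSmallCut.of_iso {H : SimpleGraph W} (e : G ≃g H) (h : HasSmallCut G) :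
    HasSmallCut H := by
  obtain ⟨A, B, T, ⟨a, ha⟩, ⟨b, hb⟩, hAB, hT, hcov⟩ := h
  refine ⟨e.symm ⁻¹' A, e.symm ⁻¹' B, T.map (e : V ≃ W).toEmbedding, ⟨e a, by simpa⟩,
    ⟨e b, by simpa⟩, fun a ha b hb => ⟨?_, ?_⟩, by simpa, fun v => ?_⟩
  · rintro rfl
    exact (hAB _ ha _ hb).1 rfl
  · intro h
    exact (hAB _ ha _ hb).2 (e.symm.map_rel_iff.2 h)
  · rcases hcov (e.symm v) with h | h | h
    · exact Or.inl h
    · exact Or.inr (Or.inl h)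
    · exact Or.inr (Or.inr (Finset.mem_map.2 ⟨_, h, e.apply_symm_apply v⟩))

theorem HasSeparatingFourCycle.hasSmallCut (h : HasSeparatingFourCycle G) : HasSmallCut G := by
  classical
  obtain ⟨a, b, c, d, -, -, -, -, -, -, h⟩ := h
  simp only [SimpleGraph.Preconnected, not_forall] at h
  obtain ⟨v, w, hvw⟩ := h
  refine ⟨{z | ∃ hz, (G.induce (({a, b, c, d} : Set V)ᶜ)).Reachable v ⟨z, hz⟩},
    {z | ∃ hz, ¬ (G.induce (({a, b, c, d} : Set V)ᶜ)).Reachable v ⟨z, hz⟩}, {a, b, c, d},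
    ⟨v, v.2, SimpleGraph.Reachable.refl _⟩, ⟨w, w.2, hvw⟩, ?_, Finset.card_le_four, fun z => ?_⟩
  · rintro x ⟨hx, hvx⟩ y ⟨hy, hvy⟩
    refine ⟨?_, fun hxy => ?_⟩
    · rintro rfl
      exact hvy hvx
    · have hadj : (G.induce (({a, b, c, d} : Set V)ᶜ)).Adj ⟨x, hx⟩ ⟨y, hy⟩ := hxy
      exact hvy (hvx.trans hadj.reachable)
  · by_cases hz : z ∈ (({a, b, c, d} : Set V)ᶜ)
    · by_cases hr : (G.induce (({a, b, c, d} : Set V)ᶜ)).Reachable v ⟨z, hz⟩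
      · exact Or.inl ⟨hz, hr⟩
      · exact Or.inr (Or.inl ⟨hz, hr⟩)
    · right; right
      rw [Set.mem_compl_iff, not_not] at hz
      simpa using hz

/-- Every added edge joins `x₄` to a neighbour of `x`. If `x` is on one side of the cut, an added
edge across it would put a neighbour of `x` on the other side, so `T` still works; a neighbour of
`x` outside `T` keeps the side of `x` nonempty. If `x` is in `T`, it is exchanged for `x₄`, which
meets all added edges; a side that contains `x₄` also contains one of its neighbours, as six
neighbours do not fit into `T`. -/
theorem HasSmallCut.reduct (hc : HasSmallCut G) (hk : HasKiteCover G) (M : CrossedStar G) :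
    HasSmallCut M.reduct := by
  classical
  obtain ⟨A, B, T, hA, hB, hAB, hT, hcov⟩ := hc
  obtain ⟨P, S, hK⟩ := hk
  have hx4 : G.Adj M.x M.x₄ := M.adj_x_iff.2 (by simp)
  have key : ∀ A B : Set V, A.Nonempty → B.Nonempty →
      (∀ a ∈ A, ∀ b ∈ B, a ≠ b ∧ ¬ G.Adj a b) → (∀ v, v ∈ A ∨ v ∈ B ∨ v ∈ T) → M.x ∈ A →
      HasSmallCut M.reduct := by
    intro A B hA hB hAB hcov hx
    obtain ⟨w, hw, hwT⟩ := hK.exists_adj_notMem hx4 T (by omega)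
    obtain ⟨b, hb⟩ := hB
    have hwB : w ∉ B := fun h => (hAB _ hx _ h).2 hw
    refine ⟨Subtype.val ⁻¹' A, Subtype.val ⁻¹' B, T.subtype _,
      ⟨⟨w, hw.ne'⟩, ((hcov w).resolve_right (by tauto))⟩,
      ⟨⟨b, (hAB _ hx _ hb).1.symm⟩, hb⟩, ?_, ?_, fun v => ?_⟩
    · intro a ha b hb
      refine ⟨?_, fun h => ?_⟩
      · rintro rfl
        exact (hAB _ ha _ hb).1 rfl
      · rw [M.reduct_adj_iff] at h
        rcases h with h | ⟨h, -⟩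
        · exact (hAB _ ha _ hb).2 h.1
        · refine (hAB _ hx _ hb).2 (M.adj_x_iff.2 ?_)
          simp only [Sym2.eq_iff] at h
          tauto
    · rw [Finset.card_subtype]
      exact (Finset.card_filter_le _ _).trans hT
    · simpa using hcov v
  by_cases hxA : M.x ∈ A
  · exact key A B hA hB hAB hcov hxA
  by_cases hxB : M.x ∈ B
  · refine key B A hB hA (fun b hb a ha => ?_) (fun v => ?_) hxB
    · exact ⟨(hAB a ha b hb).1.symm, fun h => (hAB a ha b hb).2 h.symm⟩
    · have := hcov v
      tauto
  have hxT : M.x ∈ T := by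
    have := hcov M.x
    tauto
  have hne : ∀ A B : Set V, A.Nonempty → (∀ a ∈ A, ∀ b ∈ B, a ≠ b ∧ ¬ G.Adj a b) →
      (∀ v, v ∈ A ∨ v ∈ B ∨ v ∈ T) → ∃ v ∈ A, v ≠ M.x₄ := by
    rintro A B ⟨a, ha⟩ hAB hcov
    by_cases h : a = M.x₄
    · subst h
      obtain ⟨w, hw, hwT⟩ := hK.exists_adj_notMem hx4.symm T (by omega)
      have := (hAB _ ha w)
      exact ⟨w, (hcov w).resolve_right (by tauto), hw.ne'⟩
    · exact ⟨a, ha, h⟩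
  obtain ⟨a, ha, ha4⟩ := hne A B hA hAB hcov
  obtain ⟨b, hb, hb4⟩ := hne B A hB
    (fun b hb a ha => ⟨(hAB a ha b hb).1.symm, fun h => (hAB a ha b hb).2 h.symm⟩)
    (fun v => by have := hcov v; tauto)
  refine ⟨{v | v.1 ∈ A ∧ v.1 ≠ M.x₄}, {v | v.1 ∈ B ∧ v.1 ≠ M.x₄},
    (insert M.x₄ (T.erase M.x)).subtype _, ⟨⟨a, ?_⟩, ha, ha4⟩, ⟨⟨b, ?_⟩, hb, hb4⟩, ?_, ?_,
    fun v => ?_⟩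
  · rintro rfl
    exact hxA ha
  · rintro rfl
    exact hxB hb
  · rintro a ⟨ha, ha4⟩ b ⟨hb, hb4⟩
    refine ⟨?_, fun h => ?_⟩
    · rintro rfl
      exact (hAB _ ha _ hb).1 rfl
    · rw [M.reduct_adj_iff] at h
      rcases h with h | ⟨h, -⟩
      · exact (hAB _ ha _ hb).2 h.1
      · simp only [Sym2.eq_iff] at h
        tauto
  · rw [Finset.card_subtype]
    refine (Finset.card_filter_le _ _).trans ((Finset.card_insert_le _ _).trans ?_)
    rw [Finset.card_erase_of_mem hxT]
    omega
  · have h1 := hcov v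
    have h2 : v.1 ≠ M.x := v.2
    simp only [Set.mem_ofPred_eq, Finset.mem_subtype, Finset.mem_insert, Finset.mem_erase]
    tauto

/-- A pole on one side would confine the other side to the second pole and then put all `2k ≥ 6`
cycle vertices into `T`. So `T` contains both poles and at most two cycle vertices. As the cycle has
chords of length two, passing from `A` to `B` and back from `B` to `A` uses two different pairs of
consecutive vertices of `T`, which needs three cycle vertices. -/
theorem not_hasSmallCut_extendedWheel {k : ℕ} (hk : 3 ≤ k) :
    ¬ HasSmallCut (extendedWheel k) := by
  classical
  rintro ⟨A, B, T, hA, hB, hAB, hT, hcov⟩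
  have : NeZero (2 * k) := ⟨by omega⟩
  have : Fact (1 < 2 * k) := ⟨by omega⟩
  have hpole : ∀ (i : ZMod (2 * k)) (p : Fin 2),
      (extendedWheel k).Adj (Sum.inr p) (Sum.inl i) := by
    intro i p
    simp [extendedWheel]
  have hone : ∀ i : ZMod (2 * k), (extendedWheel k).Adj (Sum.inl i) (Sum.inl (i + 1)) := by
    intro i
    simp [extendedWheel]
  have h2 : (2 : ZMod (2 * k)) ≠ 0 := by
    intro h
    have : ((2 : ℕ) : ZMod (2 * k)) = 0 := by exact_mod_cast h
    rw [ZMod.natCast_eq_zero_iff] at this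
    have := Nat.le_of_dvd (by omega) this
    omega
  have htwo : ∀ i : ZMod (2 * k), (extendedWheel k).Adj (Sum.inl i) (Sum.inl (i + 2)) := by
    intro i
    simp [extendedWheel, h2]
  have pole : ∀ A B : Set (ZMod (2 * k) ⊕ Fin 2), B.Nonempty →
      (∀ a ∈ A, ∀ b ∈ B, a ≠ b ∧ ¬ (extendedWheel k).Adj a b) →
      (∀ v, v ∈ A ∨ v ∈ B ∨ v ∈ T) → ∀ p, Sum.inr p ∉ A := by
    rintro A B ⟨b, hb⟩ hAB hcov p hp
    have hB : ∀ i, Sum.inl i ∉ B := fun i hi => (hAB _ hp _ hi).2 (hpole i p)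
    rcases b with i | q
    · exact hB i hb
    have hA : ∀ i, Sum.inl i ∉ A := fun i hi => (hAB _ hi _ hb).2 (hpole i q).symm
    have hsub : (Finset.univ.map ⟨Sum.inl, Sum.inl_injective⟩ :
        Finset (ZMod (2 * k) ⊕ Fin 2)) ⊆ T := by
      intro z hz
      simp only [Finset.mem_map, Finset.mem_univ, true_and, Function.Embedding.coeFn_mk] at hz
      obtain ⟨i, rfl⟩ := hz
      have := hcov (Sum.inl i)
      have := hA i
      have := hB i
      tauto
    have := Finset.card_le_card hsub
    rw [Finset.card_map, Finset.card_univ, ZMod.card] at this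
    omega
  have hsymm : ∀ b ∈ B, ∀ a ∈ A, b ≠ a ∧ ¬ (extendedWheel k).Adj b a :=
    fun b hb a ha => ⟨(hAB a ha b hb).1.symm, fun h => (hAB a ha b hb).2 h.symm⟩
  have hcov' : ∀ v, v ∈ B ∨ v ∈ A ∨ v ∈ T := fun v => by have := hcov v; tauto
  have hpA := pole A B hB hAB hcov
  have hpB := pole B A hA hsymm hcov'
  have hpT : ∀ p, Sum.inr p ∈ T := by
    intro p
    have := hcov (Sum.inr p)
    have := hpA p
    have := hpB p
    tauto
  have gap : ∀ A B : Set (ZMod (2 * k) ⊕ Fin 2), (∀ p, Sum.inr p ∉ A) → (∀ p, Sum.inr p ∉ B) →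
      A.Nonempty → B.Nonempty → (∀ a ∈ A, ∀ b ∈ B, a ≠ b ∧ ¬ (extendedWheel k).Adj a b) →
      (∀ v, v ∈ A ∨ v ∈ B ∨ v ∈ T) →
      ∃ i : ZMod (2 * k), Sum.inl i ∈ T ∧ Sum.inl (i + 1) ∈ T ∧ Sum.inl (i + 2) ∈ B := by
    rintro A B hpA hpB ⟨i | p, hi⟩ ⟨j | q, hj⟩ hAB hcov
    · have hex : ∃ t : ℕ, Sum.inl (i + t) ∈ B := ⟨(j - i).val, by simpa using hj⟩
      have hmin : ∀ m : ℕ, m < Nat.find hex → Sum.inl (i + m) ∉ B :=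
        fun m hm => Nat.find_min hex hm
      have hspec := Nat.find_spec hex
      generalize Nat.find hex = t at hmin hspec
      match t with
      | 0 => exact absurd rfl (hAB _ hi _ (by simpa using hspec)).1
      | 1 => exact absurd (hone i) (hAB _ hi _ (by simpa using hspec)).2
      | t + 2 =>
        have e1 : i + (t : ZMod (2 * k)) + 1 = i + ((t + 1 : ℕ) : ZMod (2 * k)) := by
          push_cast; ring
        have e2 : i + (t : ZMod (2 * k)) + 2 = i + ((t + 2 : ℕ) : ZMod (2 * k)) := by
          push_cast; ring
        rw [← e2] at hspec
        refine ⟨i + t, ?_, ?_, hspec⟩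
        · have h1 := hmin t (by omega)
          have h2 : Sum.inl (i + (t : ZMod (2 * k))) ∉ A := fun h =>
            (hAB _ h _ hspec).2 (htwo _)
          have := hcov (Sum.inl (i + (t : ZMod (2 * k))))
          tauto
        · have h1 := hmin (t + 1) (by omega)
          rw [← e1] at h1
          have h2 : Sum.inl (i + (t : ZMod (2 * k)) + 1) ∉ A := fun h => by
            refine (hAB _ h _ hspec).2 ?_
            have := hone (i + (t : ZMod (2 * k)) + 1)
            rwa [add_assoc (i + (t : ZMod (2 * k))), one_add_one_eq_two] at this
          have := hcov (Sum.inl (i + (t : ZMod (2 * k)) + 1))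
          tauto
    · exact absurd hj (hpB q)
    · exact absurd hi (hpA p)
    · exact absurd hi (hpA p)
  obtain ⟨i, hi, hi1, hi2⟩ := gap A B hpA hpB hA hB hAB hcov
  obtain ⟨j, hj, hj1, hj2⟩ := gap B A hpB hpA hB hA hsymm hcov'
  have hij : i ≠ j := by
    rintro rfl
    exact (hAB _ hj2 _ hi2).1 rfl
  -- The two poles, `i` and `i + 1` already exhaust the four places in `T`.
  have h4 : ∀ u : ZMod (2 * k), Sum.inl u ∈ T → u = i ∨ u = i + 1 := by
    intro u hu
    by_contra! hcon
    have hsub : ({Sum.inr 0, Sum.inr 1, Sum.inl i, Sum.inl (i + 1), Sum.inl u} :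
        Finset (ZMod (2 * k) ⊕ Fin 2)) ⊆ T := by
      intro z hz
      simp only [Finset.mem_insert, Finset.mem_singleton] at hz
      rcases hz with rfl | rfl | rfl | rfl | rfl
      exacts [hpT 0, hpT 1, hi, hi1, hu]
    have := Finset.card_le_card hsub
    rw [Finset.card_insert_of_notMem (by simp), Finset.card_insert_of_notMem (by simp),
      Finset.card_insert_of_notMem (by simp [hcon.1.symm]),
      Finset.card_insert_of_notMem (by simp [hcon.2.symm]), Finset.card_singleton] at this
    omega
  have r1 : j = i + 1 := (h4 j hj).resolve_left hij.symm
  rcases h4 (j + 1) hj1 with h | h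
  · rw [r1, add_assoc, one_add_one_eq_two] at h
    exact h2 (by simpa using h)
  · exact hij (add_right_cancel h).symm

/-- Small cuts survive `SR`-reductions of graphs with a kite cover. -/
theorem SRReducesTo.hasSmallCut {W : Type u} {H : SimpleGraph W} (h : SRReducesTo G H)
    (hk : HasKiteCover G) (hc : HasSmallCut G) : HasKiteCover H ∧ HasSmallCut H := by
  induction h with
  | refl => exact ⟨hk, hc⟩
  | step _ hs ih =>
    obtain ⟨M, hM, ⟨e⟩⟩ := hs
    exact ⟨(ih.1.reduct M hM).of_iso e, (ih.2.reduct ih.1 M).of_iso e⟩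

end SmallCut

/-! ### Faces of rotation systems and faces of length two. -/

section RotationSystem

variable {X : Type u} {Γ : SimpleGraph X} {σ : Equiv.Perm Γ.Dart}

theorem reversePerm_apply (d : Γ.Dart) : reversePerm Γ d = d.symm := rfl

/-- The faces of a rotation system. -/
abbrev Face (Γ : SimpleGraph X) (σ : Equiv.Perm Γ.Dart) : Type u :=
  Quotient (Equiv.Perm.SameCycle.setoid (σ * reversePerm Γ))

/-- The face on which a dart lies. -/
def faceOf (σ : Equiv.Perm Γ.Dart) (d : Γ.Dart) : Face Γ σ := Quotient.mk _ d

theorem faceOf_eq_iff {d e : Γ.Dart} :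
    faceOf σ d = faceOf σ e ↔ (σ * reversePerm Γ).SameCycle d e := Quotient.eq

theorem faceOf_next (d : Γ.Dart) : faceOf σ (σ d.symm) = faceOf σ d :=
  faceOf_eq_iff.2 (Equiv.Perm.sameCycle_apply_left.2 (Equiv.Perm.SameCycle.refl _ d))

/-- Isolated vertices are components of their own, and the component of `d` is not among them. -/
theorem card_isolated_lt [Finite X] (d : Γ.Dart) :
    {v : X | ∀ w, ¬ Γ.Adj v w}.ncard < Nat.card Γ.ConnectedComponent := by
  classical
  have : Finite Γ.ConnectedComponent := Quot.finite _
  rw [← Nat.card_coe_set_eq, Nat.lt_iff_add_one_le, ← Finite.card_option]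
  let f : Option {v : X | ∀ w, ¬ Γ.Adj v w} → Γ.ConnectedComponent :=
    fun o => o.elim (Γ.connectedComponentMk d.fst) (fun v => Γ.connectedComponentMk v.1)
  have hiso : ∀ v : X, (∀ w, ¬ Γ.Adj v w) → ∀ w, Γ.Reachable v w → w = v := by
    rintro v hv w ⟨p⟩
    cases p with
    | nil => rfl
    | cons h _ => exact absurd h (hv _)
  refine Nat.card_le_card_of_injective f ?_
  rintro (_ | ⟨v, hv⟩) (_ | ⟨w, hw⟩) h
  · rfl
  · have h' : Γ.Reachable d.fst w := SimpleGraph.ConnectedComponent.eq.1 h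
    have := hiso w hw _ h'.symm
    exact absurd d.adj (this ▸ hw _)
  · have h' : Γ.Reachable v d.fst := SimpleGraph.ConnectedComponent.eq.1 h
    have := hiso v hv _ h'
    exact absurd d.adj (this ▸ hv _)
  · have h' : Γ.Reachable v w := SimpleGraph.ConnectedComponent.eq.1 h
    have := hiso v hv w h'
    subst this
    rfl

namespace IsRotationSystem

theorem fst_apply (hσ : IsRotationSystem Γ σ) (d : Γ.Dart) : (σ d).fst = d.fst :=
  (hσ _ _).1 (Equiv.Perm.sameCycle_apply_left.2 (Equiv.Perm.SameCycle.refl σ d))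

theorem fst_next (hσ : IsRotationSystem Γ σ) (d : Γ.Dart) : (σ d.symm).fst = d.snd := hσ.fst_apply _

theorem next_ne (hσ : IsRotationSystem Γ σ) (d : Γ.Dart) : σ d.symm ≠ d := by
  intro h
  have := hσ.fst_next d
  rw [h] at this
  exact d.fst_ne_snd this

/-- A face of length two consists of a dart and a dart back; without parallel edges the latter is
the reversal. So the rotation fixes both, and both ends have degree one. -/
theorem next_eq_symm_of_next_next (hσ : IsRotationSystem Γ σ) {d : Γ.Dart}
    (h : σ (σ d.symm).symm = d) : σ d.symm = d.symm := by
  have h1 := hσ.fst_next d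
  have h2 := hσ.fst_next (σ d.symm)
  rw [h] at h2
  exact SimpleGraph.Dart.ext _ _ (Prod.ext h1 h2.symm)

theorem eq_of_apply_eq (hσ : IsRotationSystem Γ σ) {d e : Γ.Dart} (h : σ d = d)
    (he : e.fst = d.fst) : e = d := by
  obtain ⟨i, hi⟩ := (hσ d e).2 he.symm
  rw [Equiv.Perm.zpow_apply_eq_self_of_apply_eq_self h] at hi
  exact hi.symm

/-- The ends of a face of length two form a component. -/
theorem mem_of_reachable (hσ : IsRotationSystem Γ σ) {d : Γ.Dart}
    (h : σ (σ d.symm).symm = d) {x : X} (hx : Γ.Reachable d.fst x) : x = d.fst ∨ x = d.snd := by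
  have h1 := hσ.next_eq_symm_of_next_next h
  have h2 : σ d = d := by
    have := h
    rwa [h1, SimpleGraph.Dart.symm_symm] at this
  obtain ⟨w⟩ := hx
  have key : ∀ {u v : X} (w : Γ.Walk u v), (u = d.fst ∨ u = d.snd) → (v = d.fst ∨ v = d.snd) := by
    intro u v w
    induction w with
    | nil => exact id
    | @cons a b c hab w ih =>
      intro ha
      apply ih
      rcases ha with rfl | rfl
      · have := hσ.eq_of_apply_eq h2 (e := ⟨(d.fst, b), hab⟩) rfl
        right
        rw [← this]
      · have := hσ.eq_of_apply_eq h1 (e := ⟨(d.snd, b), hab⟩) rfl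
        left
        have h3 := congrArg (fun e : Γ.Dart => e.snd) this
        exact h3
  exact key w (Or.inl rfl)

/-- Send an isolated vertex or a face of length two to its component. In the second case the
component is a single edge, both darts of which lie on that one face, so the map is injective. -/
theorem card_isolated_add_card_le (hσ : IsRotationSystem Γ σ) [Finite X] :
    {v : X | ∀ w, ¬ Γ.Adj v w}.ncard +
      Nat.card {q : Face Γ σ // ∃ d, faceOf σ d = q ∧ σ (σ d.symm).symm = d} ≤
    Nat.card Γ.ConnectedComponent := by
  classical
  have : Finite Γ.Dart := Finite.of_injective _ SimpleGraph.Dart.toProd_injective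
  have : Finite (Face Γ σ) := Quotient.finite _
  have : Finite Γ.ConnectedComponent := Quot.finite _
  rw [← Nat.card_coe_set_eq, ← Nat.card_sum]
  let f : ({v : X | ∀ w, ¬ Γ.Adj v w} ⊕
      {q : Face Γ σ // ∃ d, faceOf σ d = q ∧ σ (σ d.symm).symm = d}) → Γ.ConnectedComponent :=
    Sum.elim (fun v => Γ.connectedComponentMk v.1)
      (fun q => Γ.connectedComponentMk q.2.choose.fst)
  have hiso : ∀ v : X, (∀ w, ¬ Γ.Adj v w) → ∀ w, Γ.Reachable v w → w = v := by
    rintro v hv w ⟨p⟩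
    cases p with
    | nil => rfl
    | cons h _ => exact absurd h (hv _)
  refine Nat.card_le_card_of_injective f ?_
  rintro (⟨v, hv⟩ | ⟨q, hq⟩) (⟨w, hw⟩ | ⟨r, hr⟩) h
  · have h' : Γ.Reachable v w := SimpleGraph.ConnectedComponent.eq.1 h
    have := hiso v hv w h'
    subst this
    rfl
  · have h' : Γ.Reachable v hr.choose.fst := SimpleGraph.ConnectedComponent.eq.1 h
    have := hiso v hv _ h'
    exact absurd hr.choose.adj (this ▸ hv _)
  · have h' : Γ.Reachable hq.choose.fst w := SimpleGraph.ConnectedComponent.eq.1 h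
    have := hiso w hw _ h'.symm
    exact absurd hq.choose.adj (this ▸ hw _)
  · have h' : Γ.Reachable hq.choose.fst hr.choose.fst := SimpleGraph.ConnectedComponent.eq.1 h
    have hq' := hq.choose_spec
    have hr' := hr.choose_spec
    generalize hq.choose = d at h' hq'
    generalize hr.choose = e at h' hr'
    congr 2
    rw [← hq'.1, ← hr'.1]
    have h1 := hσ.next_eq_symm_of_next_next hq'.2
    have h2 : σ d = d := by
      have := hq'.2
      rwa [h1, SimpleGraph.Dart.symm_symm] at this
    rcases hσ.mem_of_reachable hq'.2 h' with h3 | h3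
    · rw [hσ.eq_of_apply_eq h2 h3]
    · rw [hσ.eq_of_apply_eq h1 h3, ← h1, faceOf_next]

theorem card_le_two_of_next_next (hσ : IsRotationSystem Γ σ) [Finite X] {d : Γ.Dart}
    (h : σ (σ d.symm).symm = d) (hk : Nat.card Γ.ConnectedComponent = 1) : Nat.card X ≤ 2 := by
  classical
  have hs := (Nat.card_eq_one_iff_unique.1 hk).1
  have : (Set.univ : Set X) ⊆ {d.fst, d.snd} := by
    intro x _
    exact hσ.mem_of_reachable h (SimpleGraph.ConnectedComponent.eq.1 (Subsingleton.elim _ _))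
  rw [← Set.ncard_univ]
  exact (Set.ncard_le_ncard this (Set.toFinite _)).trans
    ((Set.ncard_insert_le _ _).trans (by rw [Set.ncard_singleton]))

end IsRotationSystem

end RotationSystem

/-! ### Degrees in the planarization. -/

namespace CrossingPattern

variable {V : Type u} {G : SimpleGraph V} (C : CrossingPattern G)

theorem eq_of_mem {p : Sym2 (Sym2 V)} (hp : p ∈ C.pairs) {e f : Sym2 V} {w : V} (he : e ∈ p)
    (hf : f ∈ p) (hwe : w ∈ e) (hwf : w ∈ f) : e = f := by
  by_contra hne
  have : p = s(e, f) := (Sym2.mem_and_mem_iff hne).1 ⟨he, hf⟩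
  subst this
  exact C.disjoint e f hp w hwe hwf

theorem exists_quad (p : C.pairs) : ∃ q : V × V × V × V,
    p.1 = s(s(q.1, q.2.2.1), s(q.2.1, q.2.2.2)) ∧
    [q.1, q.2.1, q.2.2.1, q.2.2.2].Nodup := by
  obtain ⟨p, hp⟩ := p
  induction p using Sym2.ind with | _ e f => ?_
  induction e using Sym2.ind with | _ a c => ?_
  induction f using Sym2.ind with | _ b d => ?_
  refine ⟨(a, b, c, d), rfl, ?_⟩
  have h1 : G.Adj a c := C.isEdge _ hp s(a, c) (by simp)
  have h2 : G.Adj b d := C.isEdge _ hp s(b, d) (by simp)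
  have h3 := C.disjoint _ _ hp a (by simp)
  have h4 := C.disjoint _ _ hp c (by simp)
  have := h1.ne
  have := h2.ne
  simp only [Sym2.mem_iff, not_or] at h3 h4
  simp
  grind

theorem adj_inr_inl_iff {p : C.pairs} {v : V} {a b c d : V} (h : p.1 = s(s(a, c), s(b, d))) :
    C.planarization.Adj (Sum.inr p) (Sum.inl v) ↔ v = a ∨ v = b ∨ v = c ∨ v = d := by
  show (∃ e ∈ p.1, v ∈ e) ↔ _
  rw [h]
  simp
  tauto

theorem ncard_neighborSet_inr (p : C.pairs) :
    (C.planarization.neighborSet (Sum.inr p)).ncard = 4 := by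
  classical
  obtain ⟨⟨a, b, c, d⟩, hp, hn⟩ := C.exists_quad p
  have : C.planarization.neighborSet (Sum.inr p) =
      (([a, b, c, d].toFinset.map ⟨Sum.inl, Sum.inl_injective⟩ : Finset (V ⊕ C.pairs)) :
        Set (V ⊕ C.pairs)) := by
    ext (v | q)
    · rw [SimpleGraph.mem_neighborSet, C.adj_inr_inl_iff hp]
      simp
    · simp [planarization]
  rw [this, Set.ncard_coe_finset, Finset.card_map, List.toFinset_card_of_nodup hn]
  rfl

/-- Replace a neighbour `b` by the crossing on `ab`, if there is one. This is injective because two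
edges at `a` never share a crossing, and surjective because an edge has at most one. -/
theorem ncard_neighborSet_inl (a : V) :
    (C.planarization.neighborSet (Sum.inl a)).ncard = (G.neighborSet a).ncard := by
  classical
  let f : ∀ b ∈ G.neighborSet a, V ⊕ C.pairs := fun b _ =>
    if h : ∃ p ∈ C.pairs, s(a, b) ∈ p then Sum.inr ⟨h.choose, h.choose_spec.1⟩ else Sum.inl b
  symm
  refine Set.ncard_congr f ?_ ?_ ?_
  · intro b hb
    by_cases h : ∃ p ∈ C.pairs, s(a, b) ∈ p
    · simp only [f, dif_pos h]
      exact ⟨s(a, b), h.choose_spec.2, by simp⟩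
    · simp only [f, dif_neg h]
      push Not at h
      exact ⟨hb, h⟩
  · intro b c hb hc hbc
    by_cases h : ∃ p ∈ C.pairs, s(a, b) ∈ p <;> by_cases h' : ∃ p ∈ C.pairs, s(a, c) ∈ p
    · simp only [f, dif_pos h, dif_pos h', Sum.inr.injEq, Subtype.mk.injEq] at hbc
      have h1 := h.choose_spec.2
      rw [hbc] at h1
      have := C.eq_of_mem h'.choose_spec.1 h1 h'.choose_spec.2 (w := a) (by simp) (by simp)
      exact Sym2.congr_right.1 this
    · simp [f, dif_pos h, dif_neg h'] at hbc
    · simp [f, dif_neg h, dif_pos h'] at hbc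
    · simpa [f, dif_neg h, dif_neg h'] using hbc
  · rintro (b | ⟨p, hp⟩) hb
    · refine ⟨b, hb.1, ?_⟩
      have : ¬ ∃ p ∈ C.pairs, s(a, b) ∈ p := by push Not; exact hb.2
      simp only [f, dif_neg this]
    · obtain ⟨e, he, hae⟩ := hb
      obtain ⟨b, rfl⟩ := Sym2.mem_iff_exists.1 hae
      have h : ∃ p ∈ C.pairs, s(a, b) ∈ p := ⟨p, hp, he⟩
      refine ⟨b, C.isEdge p hp _ he, ?_⟩
      simp only [f, dif_pos h, Sum.inr.injEq, Subtype.mk.injEq]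
      exact C.crossedOnce _ h.choose_spec.1 _ hp _ h.choose_spec.2 he

end CrossingPattern

/-! ### Euler's formula makes every face a triangle with one crossing. -/

section Triangulation

variable {V : Type u} {G : SimpleGraph V} {C : CrossingPattern G}
  {σ : Equiv.Perm C.planarization.Dart}

/-- The two halves of a crossed edge are opposite to each other at the crossing. -/
def IsOppositeAtCrossings (C : CrossingPattern G) (σ : Equiv.Perm C.planarization.Dart) : Prop :=
  ∀ (d : C.planarization.Dart) (p : C.pairs) (a b : V),
    d.fst = Sum.inr p → d.snd = Sum.inl a → s(a, b) ∈ p.1 → (σ (σ d)).snd = Sum.inl b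

theorem exists_snd_eq_inl {d : C.planarization.Dart} {p : C.pairs} (hd : d.fst = Sum.inr p) :
    ∃ a, d.snd = Sum.inl a := by
  have := d.adj
  rw [hd] at this
  rcases h : d.snd with a | q
  · exact ⟨a, rfl⟩
  · rw [h] at this
    exact this.elim

/-- A fixed half-edge would be its own opposite, giving a loop. -/
theorem IsOppositeAtCrossings.apply_ne (ho : IsOppositeAtCrossings C σ)
    {d : C.planarization.Dart} {p : C.pairs} (hd : d.fst = Sum.inr p) : σ d ≠ d := by
  intro h
  obtain ⟨a, ha⟩ := exists_snd_eq_inl hd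
  have := d.adj
  rw [hd, ha] at this
  obtain ⟨e, he, hae⟩ := this
  obtain ⟨b, rfl⟩ := Sym2.mem_iff_exists.1 hae
  have h2 := ho d p a b hd ha he
  rw [h, h, ha] at h2
  have hadj : G.Adj a b := C.isEdge _ p.2 _ he
  exact hadj.ne (Sum.inl.inj h2)

open Classical in
theorem degree_planarization_inl [Fintype V] [Fintype C.pairs] (a : V) :
    C.planarization.degree (Sum.inl a) = G.degree a := by
  rw [← SimpleGraph.card_neighborFinset_eq_degree, ← SimpleGraph.card_neighborFinset_eq_degree,
    ← Set.ncard_coe_finset, ← Set.ncard_coe_finset, SimpleGraph.coe_neighborFinset,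
    SimpleGraph.coe_neighborFinset, C.ncard_neighborSet_inl]

open Classical in
theorem card_filter_isLeft [Fintype V] [Fintype C.pairs] :
    (Finset.univ.filter fun d : C.planarization.Dart => d.fst.isLeft).card =
      2 * G.edgeSet.ncard := by
  have h1 : ∀ v : V ⊕ C.pairs, (Finset.univ.filter fun d : C.planarization.Dart =>
      d.fst.isLeft ∧ d.fst = v).card = if v.isLeft then C.planarization.degree v else 0 := by
    intro v
    rw [← SimpleGraph.dart_fst_fiber_card_eq_degree]
    split_ifs with h
    · congr 1
      ext d
      simp only [Finset.mem_filter, Finset.mem_univ, true_and]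
      exact ⟨fun h => h.2, fun h' => ⟨h' ▸ h, h'⟩⟩
    · rw [Finset.card_eq_zero, Finset.filter_eq_empty_iff]
      rintro d - ⟨h1, rfl⟩
      exact h h1
  rw [Finset.card_eq_sum_card_fiberwise (t := Finset.univ) (f := fun d => d.fst) (by simp)]
  simp only [Finset.filter_filter, h1]
  rw [Fintype.sum_sum_type]
  simp only [Sum.isLeft_inl, if_true, Sum.isLeft_inr, Bool.false_eq_true, if_false,
    Finset.sum_const_zero, add_zero, degree_planarization_inl]
  rw [G.sum_degrees_eq_twice_card_edges, ← SimpleGraph.coe_edgeFinset, Set.ncard_coe_finset]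

open Classical in
-- Handshake: original vertices keep their degrees and every crossing has degree four.
theorem ncard_edgeSet_planarization [Fintype V] [Fintype C.pairs] :
    C.planarization.edgeSet.ncard = G.edgeSet.ncard + 2 * Nat.card C.pairs := by
  have h3 : ∀ p, C.planarization.degree (Sum.inr p) = 4 := by
    intro p
    rw [← SimpleGraph.card_neighborFinset_eq_degree,
      ← Set.ncard_coe_finset, SimpleGraph.coe_neighborFinset, C.ncard_neighborSet_inr]
  have h4 := C.planarization.sum_degrees_eq_twice_card_edges
  rw [Fintype.sum_sum_type] at h4
  simp only [degree_planarization_inl, h3, Finset.sum_const, Finset.card_univ, smul_eq_mul,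
    G.sum_degrees_eq_twice_card_edges] at h4
  rw [← SimpleGraph.coe_edgeFinset, ← SimpleGraph.coe_edgeFinset, Set.ncard_coe_finset,
    Set.ncard_coe_finset, Nat.card_eq_fintype_card]
  omega

/-- In a 1-planar embedding with `4 n - 8` edges all faces of the planarization are triangles, and
each has a crossing on its boundary. -/
theorem IsPlanarRotation.triangles [Finite V] (hσ : IsPlanarRotation C.planarization σ)
    (ho : IsOppositeAtCrossings C σ) (hV : 3 ≤ Nat.card V)
    (hG : G.edgeSet.ncard + 8 = 4 * Nat.card V) (d : C.planarization.Dart) :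
    σ (σ (σ d.symm).symm).symm = d ∧
      ∀ a b, d.fst = Sum.inl a → d.snd = Sum.inl b → ∃ p, (σ d.symm).snd = Sum.inr p := by
  classical
  have := Fintype.ofFinite V
  have := Fintype.ofFinite C.pairs
  obtain ⟨hr, heuler⟩ := hσ
  have : Finite (Face C.planarization σ) := Quotient.finite _
  have := Fintype.ofFinite (Face C.planarization σ)
  let L : Face C.planarization σ → Finset C.planarization.Dart := fun q =>
    Finset.univ.filter fun d => faceOf σ d = q
  let R : Face C.planarization σ → Finset C.planarization.Dart := fun q =>
    Finset.univ.filter fun d => d.fst.isLeft ∧ faceOf σ d = q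
  let two : Face C.planarization σ → Prop := fun q =>
    ∃ d, faceOf σ d = q ∧ σ (σ d.symm).symm = d
  have hsurj : ∀ q : Face C.planarization σ, ∃ d, faceOf σ d = q := Quotient.exists_rep
  have hmemL : ∀ d q, d ∈ L q ↔ faceOf σ d = q := by simp [L]
  have hmemR : ∀ d q, d ∈ R q ↔ d.fst.isLeft ∧ faceOf σ d = q := by simp [R]
  have hLsum : ∑ q, (L q).card = 2 * (G.edgeSet.ncard + 2 * Nat.card C.pairs) := by
    rw [← Finset.card_eq_sum_card_fiberwise (by simp), Finset.card_univ,
      C.planarization.dart_card_eq_twice_card_edges, ← ncard_edgeSet_planarization,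
      ← SimpleGraph.coe_edgeFinset, Set.ncard_coe_finset]
  have hRsum : ∑ q, (R q).card = 2 * G.edgeSet.ncard := by
    rw [← card_filter_isLeft (C := C),
      Finset.card_eq_sum_card_fiberwise (t := Finset.univ) (f := faceOf σ) (by simp)]
    simp only [Finset.filter_filter, R]
  have hL : ∀ q, 3 ≤ (L q).card + if two q then 1 else 0 := by
    intro q
    obtain ⟨d, rfl⟩ := hsurj q
    have hcard : 2 ≤ (L (faceOf σ d)).card := by
      rw [← Finset.card_pair (hr.next_ne d)]
      apply Finset.card_le_card
      intro e he
      rw [hmemL]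
      rcases Finset.mem_insert.1 he with rfl | he
      · exact faceOf_next d
      · rw [Finset.mem_singleton.1 he]
    split_ifs with h
    · omega
    · have h1 : σ (σ d.symm).symm ≠ d := fun h1 => h ⟨d, rfl, h1⟩
      rw [add_zero, ← Finset.card_eq_three.2 ⟨_, _, _, (hr.next_ne d).symm, h1.symm,
        (hr.next_ne (σ d.symm)).symm, rfl⟩]
      apply Finset.card_le_card
      intro e he
      rw [hmemL]
      simp only [Finset.mem_insert, Finset.mem_singleton] at he
      rcases he with rfl | rfl | rfl
      · rfl
      · exact faceOf_next d
      · rw [faceOf_next, faceOf_next]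
  -- Crossings are never adjacent, so of two consecutive darts on a face one leaves an original
  -- vertex. A second such dart exists because no face of length two passes through a crossing.
  have hR : ∀ q, 2 ≤ (R q).card := by
    intro q
    obtain ⟨d, rfl, hd⟩ : ∃ d : C.planarization.Dart, faceOf σ d = q ∧ d.fst.isLeft := by
      obtain ⟨d, rfl⟩ := hsurj q
      rcases h : d.fst with a | p
      · exact ⟨d, rfl, by simp [h]⟩
      · obtain ⟨a, ha⟩ := exists_snd_eq_inl h
        exact ⟨σ d.symm, faceOf_next d, by rw [hr.fst_next, ha]; rfl⟩
    obtain ⟨e, hne, he, he'⟩ : ∃ e : C.planarization.Dart,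
        d ≠ e ∧ faceOf σ e = faceOf σ d ∧ e.fst.isLeft := by
      rcases h : d.snd with a | p
      · exact ⟨σ d.symm, (hr.next_ne d).symm, faceOf_next d, by rw [hr.fst_next, h]; rfl⟩
      · have h1 := hr.fst_next d
        rw [h] at h1
        obtain ⟨a, ha⟩ := exists_snd_eq_inl h1
        refine ⟨σ (σ d.symm).symm, fun h2 => ?_, by rw [faceOf_next, faceOf_next],
          by rw [hr.fst_next, ha]; rfl⟩
        exact ho.apply_ne (d := d.symm) h (hr.next_eq_symm_of_next_next h2.symm)
    rw [← Finset.card_pair hne]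
    apply Finset.card_le_card
    intro z hz
    rw [hmemR]
    rcases Finset.mem_insert.1 hz with rfl | hz
    · exact ⟨hd, rfl⟩
    · rw [Finset.mem_singleton.1 hz]
      exact ⟨he', he⟩
  have htwo : Nat.card {q : Face C.planarization σ // two q} = ∑ q, if two q then 1 else 0 := by
    rw [Nat.card_eq_fintype_card, Fintype.card_subtype, Finset.card_filter]
  have hkt := hr.card_isolated_add_card_le
  have hk := card_isolated_lt d
  have hf : Nat.card (Face C.planarization σ) = ∑ q : Face C.planarization σ, 1 := by
    simp [Nat.card_eq_fintype_card]
  change Nat.card (V ⊕ C.pairs) + (Nat.card (Face C.planarization σ) + _) = _ at heuler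
  rw [Nat.card_sum, ncard_edgeSet_planarization] at heuler
  have h3 : 3 * Nat.card (Face C.planarization σ) ≤
      2 * (G.edgeSet.ncard + 2 * Nat.card C.pairs) +
        Nat.card {q : Face C.planarization σ // two q} := by
    rw [hf, Finset.mul_sum, htwo, ← hLsum, ← Finset.sum_add_distrib]
    exact Finset.sum_le_sum fun q _ => hL q
  have h2 : 2 * Nat.card (Face C.planarization σ) ≤ 2 * G.edgeSet.ncard := by
    rw [hf, Finset.mul_sum, ← hRsum]
    exact Finset.sum_le_sum fun q _ => hR q
  -- With `k` components, `i` isolated vertices and `t` faces of length two, the two bounds, Euler's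
  -- formula and the edge count give `8k ≤ 8 + 4i + t`. Since `i + t ≤ k` and `i < k`, this means `k
  -- = 1`; then a face of length two would leave at most two vertices.
  have hnotwo : Nat.card {q : Face C.planarization σ // two q} = 0 := by
    by_contra hpos
    have hk1 : Nat.card C.planarization.ConnectedComponent = 1 := by
      change _ + Nat.card {q : Face C.planarization σ // two q} ≤ _ at hkt
      omega
    obtain ⟨⟨q, d, -, hd⟩⟩ := (Nat.card_pos_iff.1 (Nat.pos_of_ne_zero hpos)).1
    have := hr.card_le_two_of_next_next hd hk1
    rw [Nat.card_sum] at this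
    omega
  have hno : ∀ q, ¬ two q := by
    intro q hq
    have := Finite.card_eq_zero_iff.1 hnotwo
    exact this.elim ⟨q, hq⟩
  simp only [hno, if_false, add_zero] at hL
  -- Now both bounds are equalities in total, hence on every face.
  have hk1 : Nat.card C.planarization.ConnectedComponent = 1 := by omega
  have hf1 : Nat.card (Face C.planarization σ) = G.edgeSet.ncard := by omega
  have hL3 : (L (faceOf σ d)).card = 3 := by
    have : ∑ q : Face C.planarization σ, 3 = ∑ q, (L q).card := by
      rw [hLsum, Finset.sum_const, Finset.card_univ, ← Nat.card_eq_fintype_card, smul_eq_mul]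
      omega
    exact ((Finset.sum_eq_sum_iff_of_le fun q _ => hL q).1 this _ (Finset.mem_univ _)).symm
  have hR2 : (R (faceOf σ d)).card = 2 := by
    have : ∑ q : Face C.planarization σ, 2 = ∑ q, (R q).card := by
      rw [hRsum, Finset.sum_const, Finset.card_univ, ← Nat.card_eq_fintype_card, smul_eq_mul]
      omega
    exact ((Finset.sum_eq_sum_iff_of_le fun q _ => hR q).1 this _ (Finset.mem_univ _)).symm
  have hd2 : ∀ d : C.planarization.Dart, σ (σ d.symm).symm ≠ d := fun d h1 => hno _ ⟨d, rfl, h1⟩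
  have hcard3 : ({d, σ d.symm, σ (σ d.symm).symm} : Finset C.planarization.Dart).card = 3 :=
    Finset.card_eq_three.2 ⟨_, _, _, (hr.next_ne d).symm, (hd2 d).symm,
        (hr.next_ne (σ d.symm)).symm, rfl⟩
  have hsub : ({d, σ d.symm, σ (σ d.symm).symm} : Finset C.planarization.Dart) ⊆
      L (faceOf σ d) := by
    intro e he
    rw [hmemL]
    simp only [Finset.mem_insert, Finset.mem_singleton] at he
    rcases he with rfl | rfl | rfl
    · rfl
    · exact faceOf_next d
    · rw [faceOf_next, faceOf_next]
  have heq := Finset.eq_of_subset_of_card_le hsub (by rw [hL3, hcard3])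
  constructor
  · have : σ (σ (σ d.symm).symm).symm ∈ L (faceOf σ d) := by
      rw [hmemL, faceOf_next, faceOf_next, faceOf_next]
    rw [← heq] at this
    simp only [Finset.mem_insert, Finset.mem_singleton] at this
    rcases this with h | h | h
    · exact h
    · exact absurd h (hd2 _)
    · exact absurd h (hr.next_ne _)
  · intro a b ha hb
    rcases h : (σ d.symm).snd with c | p
    · exfalso
      -- Without a crossing all three darts of the triangle would leave original vertices, but only
      -- two do.
      have : ({d, σ d.symm, σ (σ d.symm).symm} : Finset C.planarization.Dart) ⊆ R (faceOf σ d) := by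
        intro e he
        rw [hmemR]
        refine ⟨?_, (hmemL _ _).1 (hsub he)⟩
        simp only [Finset.mem_insert, Finset.mem_singleton] at he
        rcases he with rfl | rfl | rfl
        · rw [ha]; rfl
        · rw [hr.fst_next, hb]; rfl
        · rw [hr.fst_next, h]; rfl
      have := Finset.card_le_card this
      omega
    · exact ⟨p, rfl⟩

end Triangulation

/-! ### From triangular faces to a kite cover. -/

section KitesOfTriangulation

variable {V : Type u} {G : SimpleGraph V} {C : CrossingPattern G}
  {σ : Equiv.Perm C.planarization.Dart}

theorem dart_eq_of_fst_of_snd {X : Type u} {Γ : SimpleGraph X} {d e : Γ.Dart} (h₁ : d.fst = e.fst)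
    (h₂ : d.snd = e.snd) : d = e :=
  SimpleGraph.Dart.ext _ _ (Prod.ext h₁ h₂)

/-- Consecutive ends at a crossing span a triangular face with the crossing. -/
theorem exists_dart_of_consecutive (hr : IsRotationSystem C.planarization σ)
    (ht : ∀ d : C.planarization.Dart, σ (σ (σ d.symm).symm).symm = d)
    {e : C.planarization.Dart} {p : C.pairs} {a b : V} (hp : e.fst = Sum.inr p)
    (ha : e.snd = Sum.inl a) (hb : (σ e).snd = Sum.inl b) :
    ∃ d : C.planarization.Dart, d.fst = Sum.inl b ∧ d.snd = Sum.inl a ∧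
      (σ d.symm).snd = Sum.inr p := by
  have h1 := ht e.symm
  rw [SimpleGraph.Dart.symm_symm] at h1
  have h2 := hr.fst_next (σ e)
  have h3 := hr.fst_next (σ (σ e).symm)
  rw [h1] at h3
  refine ⟨σ (σ e).symm, h2.trans hb, h3.symm.trans ha, ?_⟩
  rw [h1]
  exact hp

/-- The square of the rotation at `p` exchanges opposite ends, so the end after `a` is `b` or `d`.
In the second case `a` comes after `b`. Either way `a`, `b` are consecutive and span a triangle with
`p`; the disjunction records its orientation. -/
theorem exists_dart_of_quad (hr : IsRotationSystem C.planarization σ)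
    (ho : IsOppositeAtCrossings C σ)
    (ht : ∀ d : C.planarization.Dart, σ (σ (σ d.symm).symm).symm = d)
    {p : C.pairs} {a b c d : V} (hp : p.1 = s(s(a, c), s(b, d))) :
    ∃ f : C.planarization.Dart, f.fst = Sum.inl a ∧ f.snd = Sum.inl b ∧
      ((σ f.symm).snd = Sum.inr p ∨ (σ f).snd = Sum.inr p) := by
  let A : C.planarization.Dart := ⟨(Sum.inr p, Sum.inl a), (C.adj_inr_inl_iff hp).2 (by simp)⟩
  let B : C.planarization.Dart := ⟨(Sum.inr p, Sum.inl b), (C.adj_inr_inl_iff hp).2 (by simp)⟩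
  let C' : C.planarization.Dart := ⟨(Sum.inr p, Sum.inl c), (C.adj_inr_inl_iff hp).2 (by simp)⟩
  let D : C.planarization.Dart := ⟨(Sum.inr p, Sum.inl d), (C.adj_inr_inl_iff hp).2 (by simp)⟩
  have hfst : ∀ e : C.planarization.Dart, e.fst = Sum.inr p → (σ e).fst = Sum.inr p :=
    fun e he => (hr.fst_apply e).trans he
  have hAC : σ (σ A) = C' := dart_eq_of_fst_of_snd (hfst _ (hfst _ rfl))
    (ho A p a c rfl rfl (by simp [hp]))
  have hCA : σ (σ C') = A := dart_eq_of_fst_of_snd (hfst _ (hfst _ rfl))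
    (ho C' p c a rfl rfl (by simp [hp, Sym2.eq_swap]))
  have hDB : σ (σ D) = B := dart_eq_of_fst_of_snd (hfst _ (hfst _ rfl))
    (ho D p d b rfl rfl (by rw [hp, Sym2.eq_swap (a := d)]; simp))
  have hσA : σ A = A ∨ σ A = B ∨ σ A = C' ∨ σ A = D := by
    obtain ⟨v, hv⟩ := exists_snd_eq_inl (hfst A rfl)
    have hadj := (σ A).adj
    rw [hfst A rfl, hv, C.adj_inr_inl_iff hp] at hadj
    rcases hadj with rfl | rfl | rfl | rfl
    · exact Or.inl (dart_eq_of_fst_of_snd (hfst A rfl) hv)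
    · exact Or.inr (Or.inl (dart_eq_of_fst_of_snd (hfst A rfl) hv))
    · exact Or.inr (Or.inr (Or.inl (dart_eq_of_fst_of_snd (hfst A rfl) hv)))
    · exact Or.inr (Or.inr (Or.inr (dart_eq_of_fst_of_snd (hfst A rfl) hv)))
  rcases hσA with h | h | h | h
  · exact absurd h (ho.apply_ne (p := p) rfl)
  · obtain ⟨f, h1, h2, h3⟩ := exists_dart_of_consecutive hr ht (e := A) rfl rfl
      (by rw [h] : (σ A).snd = Sum.inl b)
    exact ⟨f.symm, h2, h1, Or.inr h3⟩
  · rw [h] at hAC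
    exact absurd hAC (ho.apply_ne (p := p) rfl)
  · rw [h] at hAC
    rw [hAC] at hDB
    rw [hDB] at hCA
    obtain ⟨f, h1, h2, h3⟩ := exists_dart_of_consecutive hr ht (e := B) rfl rfl
      (by rw [hCA] : (σ B).snd = Sum.inl a)
    exact ⟨f, h1, h2, Or.inl h3⟩

theorem exists_quad_of_mem_sides {p : Sym2 (Sym2 V)} {q : V × V × V × V}
    (hp : p = s(s(q.1, q.2.2.1), s(q.2.1, q.2.2.2))) {a b : V} (h : s(a, b) ∈ sides q) :
    ∃ c d, p = s(s(a, c), s(b, d)) := by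
  obtain ⟨q₁, q₂, q₃, q₄⟩ := q
  subst hp
  rcases mem_sides.1 h with h | h | h | h <;> rcases Sym2.eq_iff.1 h with ⟨rfl, rfl⟩ | ⟨rfl, rfl⟩
  · exact ⟨q₃, q₄, rfl⟩
  · exact ⟨q₄, q₃, Sym2.eq_swap⟩
  · exact ⟨q₄, q₁, by simp only [Sym2.eq_swap (a := q₁)]; exact Sym2.eq_swap⟩
  · exact ⟨q₁, q₄, by simp only [Sym2.eq_swap (a := q₁)]⟩
  · exact ⟨q₁, q₂, by simp only [Sym2.eq_swap (a := q₁), Sym2.eq_swap (a := q₂)]⟩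
  · exact ⟨q₂, q₁, by
      simp only [Sym2.eq_swap (a := q₁), Sym2.eq_swap (a := q₂)]; exact Sym2.eq_swap⟩
  · exact ⟨q₂, q₃, by simp only [Sym2.eq_swap (a := q₂)]; exact Sym2.eq_swap⟩
  · exact ⟨q₃, q₂, by simp only [Sym2.eq_swap (a := q₂)]⟩

/-- The edge `ab` is uncrossed, so it cannot be one of the two crossing diagonals. -/
theorem mem_sides_of_adj {p : C.pairs} {q : V × V × V × V}
    (hp : p.1 = s(s(q.1, q.2.2.1), s(q.2.1, q.2.2.2))) {a b : V}
    (hab : C.planarization.Adj (Sum.inl a) (Sum.inl b))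
    (ha : C.planarization.Adj (Sum.inr p) (Sum.inl a))
    (hb : C.planarization.Adj (Sum.inr p) (Sum.inl b)) : s(a, b) ∈ sides q := by
  obtain ⟨q₁, q₂, q₃, q₄⟩ := q
  have h1 : a ≠ b := hab.1.ne
  have h2 : s(a, b) ∉ p.1 := hab.2 p.1 p.2
  rw [C.adj_inr_inl_iff hp] at ha hb
  simp only [hp, Sym2.mem_iff, not_or, Sym2.eq_iff] at h2
  simp only [mem_sides, Sym2.eq_iff]
  rcases ha with rfl | rfl | rfl | rfl <;> rcases hb with rfl | rfl | rfl | rfl <;> simp at h1 h2 ⊢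

theorem nodup_sides {q : V × V × V × V} (h : [q.1, q.2.1, q.2.2.1, q.2.2.2].Nodup) :
    (sides q).Nodup := by
  obtain ⟨a, b, c, d⟩ := q
  simp only [List.nodup_cons, List.mem_cons, List.not_mem_nil, or_false, not_or,
    List.nodup_nil, not_false_eq_true, and_true] at h
  simp only [sides, Multiset.singleton_add, Multiset.cons_add, Multiset.nodup_cons,
    Multiset.mem_cons, Multiset.mem_singleton, Multiset.nodup_singleton, Sym2.eq_iff]
  grind

theorem nodup_diagonals {q : V × V × V × V} (h : [q.1, q.2.1, q.2.2.1, q.2.2.2].Nodup) :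
    (diagonals q).Nodup := by
  obtain ⟨a, b, c, d⟩ := q
  simp only [List.nodup_cons, List.mem_cons, List.not_mem_nil, or_false, not_or,
    List.nodup_nil, not_false_eq_true, and_true] at h
  simp only [diagonals, Multiset.singleton_add, Multiset.nodup_cons,
    Multiset.mem_singleton, Multiset.nodup_singleton, Sym2.eq_iff]
  grind

/-- The crossed pairs of edges of a triangulated 1-planar embedding form a kite cover. -/
theorem hasKiteCover_of_triangles [Finite V] (hr : IsRotationSystem C.planarization σ)
    (ho : IsOppositeAtCrossings C σ)
    (ht : ∀ d : C.planarization.Dart, σ (σ (σ d.symm).symm).symm = d)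
    (hc : ∀ (d : C.planarization.Dart) (a b : V), d.fst = Sum.inl a → d.snd = Sum.inl b →
      ∃ p, (σ d.symm).snd = Sum.inr p) : HasKiteCover G := by
  classical
  have := Fintype.ofFinite V
  have := Fintype.ofFinite C.pairs
  choose q hq hqn using C.exists_quad
  have hmemd : ∀ p e, e ∈ diagonals (q p) ↔ e ∈ p.1 := by
    intro p e
    rw [hq p]
    exact mem_diagonals.trans (by simp)
  let P : Multiset (V × V × V × V) := (Finset.univ : Finset C.pairs).val.map q
  let S : Finset (Sym2 V) := Finset.univ.filter fun e => e ∈ G.edgeSet ∧ ∀ p ∈ C.pairs, e ∉ p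
  have hPd : P.bind diagonals = (Finset.univ : Finset C.pairs).val.bind fun p => diagonals (q p) :=
    Multiset.bind_map _ _ _
  have hPs : P.bind sides = (Finset.univ : Finset C.pairs).val.bind fun p => sides (q p) :=
    Multiset.bind_map _ _ _
  have hmemD : ∀ e, e ∈ P.bind diagonals ↔ ∃ p ∈ C.pairs, e ∈ p := by
    intro e
    rw [hPd, Multiset.mem_bind]
    constructor
    · rintro ⟨p, -, h⟩
      exact ⟨p.1, p.2, (hmemd p e).1 h⟩
    · rintro ⟨p, hp, h⟩
      exact ⟨⟨p, hp⟩, Finset.mem_univ_val _, (hmemd ⟨p, hp⟩ e).2 h⟩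
  have hmemS : ∀ e, e ∈ S.val ↔ e ∈ G.edgeSet ∧ ∀ p ∈ C.pairs, e ∉ p := by
    intro e
    rw [Finset.mem_val]
    simp [S]
  refine ⟨P, S.val, ?_, ?_, ?_⟩
  · ext e
    have hcount : ∀ p, (sides (q p)).count e = if e ∈ sides (q p) then 1 else 0 := fun p =>
      Multiset.count_eq_of_nodup (nodup_sides (hqn p))
    rw [hPs, Multiset.count_bind, Multiset.count_nsmul, Multiset.count_eq_of_nodup S.nodup]
    change (∑ p : C.pairs, (sides (q p)).count e) = _
    simp only [hcount, ← Finset.card_filter]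
    induction e using Sym2.ind with | _ a b => ?_
    split_ifs with he
    · rw [hmemS] at he
      let d : C.planarization.Dart := ⟨(Sum.inl a, Sum.inl b), he⟩
      obtain ⟨p₁, hp₁⟩ := hc d a b rfl rfl
      obtain ⟨p₂, hp₂⟩ := hc d.symm b a rfl rfl
      have key : ∀ (f : C.planarization.Dart) (p : C.pairs) (u v : V), f.fst = Sum.inl u →
          f.snd = Sum.inl v → (σ f.symm).snd = Sum.inr p →
          ∃ e₁ e₂ : C.planarization.Dart, e₁.fst = Sum.inr p ∧ e₁.snd = Sum.inl v ∧
            e₂.fst = Sum.inr p ∧ e₂.snd = Sum.inl u ∧ σ e₁ = e₂ := by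
        intro f p u v hu hv hp
        have h1 := hr.fst_next f
        have h2 := hr.fst_next (σ f.symm)
        have h3 := hr.fst_next (σ (σ f.symm).symm)
        rw [ht f] at h3
        exact ⟨(σ f.symm).symm, _, hp, h1.trans hv, h2.trans hp, h3.symm.trans hu, rfl⟩
      obtain ⟨e₁, e₂, r₁, r₂, r₃, r₄, r₅⟩ := key d p₁ a b rfl rfl hp₁
      obtain ⟨e₃, e₄, t₁, t₂, t₃, t₄, t₅⟩ := key d.symm p₂ b a rfl rfl hp₂
      -- If both triangles at `ab` had the same crossing, its rotation would interchange the two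
      -- half-edges, and the one to `b` would be its own opposite.
      have hne : p₁ ≠ p₂ := by
        rintro rfl
        have h1 : e₃ = e₂ := dart_eq_of_fst_of_snd (t₁.trans r₃.symm) (t₂.trans r₄.symm)
        have h2 : e₄ = e₁ := dart_eq_of_fst_of_snd (t₃.trans r₁.symm) (t₄.trans r₂.symm)
        have hadj := e₁.adj
        rw [r₁, r₂] at hadj
        obtain ⟨e, he, hbe⟩ := hadj
        obtain ⟨c, rfl⟩ := Sym2.mem_iff_exists.1 hbe
        have h3 := ho e₁ p₁ b c r₁ r₂ he
        rw [r₅, ← h1, t₅, h2, r₂] at h3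
        exact (C.isEdge _ p₁.2 _ he : G.Adj b c).ne (Sum.inl.inj h3)
      -- The quadrilaterals with side `ab` are those of the crossings in the two triangles at this
      -- edge.
      have hset : (Finset.univ.filter fun p => s(a, b) ∈ sides (q p)) = {p₁, p₂} := by
        ext p
        simp only [Finset.mem_filter, Finset.mem_univ, true_and, Finset.mem_insert,
          Finset.mem_singleton]
        constructor
        · intro h
          obtain ⟨c, c', hp⟩ := exists_quad_of_mem_sides (hq p) h
          obtain ⟨f, hf₁, hf₂, hf⟩ := exists_dart_of_quad hr ho ht hp
          obtain rfl : f = d := dart_eq_of_fst_of_snd hf₁ hf₂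
          rcases hf with hf | hf
          · exact Or.inl (Sum.inr.inj (hf.symm.trans hp₁))
          · rw [SimpleGraph.Dart.symm_symm] at hp₂
            exact Or.inr (Sum.inr.inj (hf.symm.trans hp₂))
        · rintro (rfl | rfl)
          · have a1 := e₁.adj
            have a2 := e₂.adj
            rw [r₁, r₂] at a1
            rw [r₃, r₄] at a2
            exact mem_sides_of_adj (hq p) d.adj a2 a1
          · have a1 := e₃.adj
            have a2 := e₄.adj
            rw [t₁, t₂] at a1
            rw [t₃, t₄] at a2
            exact mem_sides_of_adj (hq p) d.adj a1 a2
      rw [hset, Finset.card_pair hne]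
    · rw [mul_zero, Finset.card_eq_zero, Finset.filter_eq_empty_iff]
      intro p _ h
      obtain ⟨c, c', hp⟩ := exists_quad_of_mem_sides (hq p) h
      obtain ⟨f, hf₁, hf₂, -⟩ := exists_dart_of_quad hr ho ht hp
      have hadj := f.adj
      rw [hf₁, hf₂] at hadj
      exact he ((hmemS _).2 hadj)
  · rw [Multiset.nodup_add]
    refine ⟨S.nodup, ?_, ?_⟩
    · rw [hPd, Multiset.nodup_bind]
      refine ⟨fun p _ => nodup_diagonals (hqn p), ?_⟩
      refine Multiset.Nodup.pairwise (fun p _ r _ hpr => ?_) (Finset.univ : Finset C.pairs).nodup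
      refine Multiset.disjoint_left.2 fun h1 h2 => hpr (Subtype.ext ?_)
      exact C.crossedOnce _ p.2 _ r.2 _ ((hmemd _ _).1 h1) ((hmemd _ _).1 h2)
    · rw [Multiset.disjoint_left]
      intro e h1 h2
      obtain ⟨p, hp, h⟩ := (hmemD e).1 h2
      exact ((hmemS e).1 h1).2 p hp h
  · intro e
    rw [Multiset.mem_add, hmemD, hmemS]
    constructor
    · rintro (h | ⟨p, hp, h⟩)
      · exact h.1
      · exact C.isEdge p hp e h
    · intro h
      by_cases h' : ∃ p ∈ C.pairs, e ∈ p
      · exact Or.inr h'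
      · push Not at h'
        exact Or.inl ⟨h, h'⟩

theorem IsOptimalOnePlanar.hasKiteCover [Finite V] (h : IsOptimalOnePlanar G) :
    HasKiteCover G := by
  obtain ⟨hV, ⟨C, σ, hσ, ho⟩, hG⟩ := h
  exact hasKiteCover_of_triangles hσ.1 ho (fun d => (hσ.triangles ho hV hG d).1)
    (fun d => (hσ.triangles ho hV hG d).2)

end KitesOfTriangulation

/-! ### Drawings from tables of glued quadrilaterals. -/

section KiteMap

variable {V : Type u} {ι : Type v}

/-- A quadrangulation of an oriented closed surface, given by its quadrilaterals `Q p` and the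
involution `mate` of their sides, so that the edges of `G` are the sides and the diagonals. -/
structure IsKiteMap (G : SimpleGraph V) (Q : ι → Fin 4 → V) (mate : ι × Fin 4 → ι × Fin 4) :
    Prop where
  adj_iff : ∀ a b, G.Adj a b ↔
    ∃ p i, Q p i = a ∧ (Q p (i + 1) = b ∨ Q p (i + 2) = b)
  mate_mate : ∀ c, mate (mate c) = c
  mate_vertex : ∀ c, Q (mate c).1 (mate c).2 = Q c.1 (c.2 + 1)
  side_inj : ∀ p i q j, Q p i = Q q j → Q p (i + 1) = Q q (j + 1) → p = q ∧ i = j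
  diagonal_inj : ∀ p i q j, Q p i = Q q j → Q p (i + 2) = Q q (j + 2) → p = q ∧ i = j
  side_ne_diagonal : ∀ p i q j, Q p i = Q q j → Q p (i + 1) ≠ Q q (j + 2)
  surjective : ∀ a, ∃ p i, Q p i = a
  -- Crossing a side and taking the next one keeps the starting vertex. Transitivity says that the
  -- quadrilaterals at a vertex form one cycle, so the surface is not pinched there.
  rotation : ∀ c c' : ι × Fin 4, Q c.1 c.2 = Q c'.1 c'.2 →
    ∃ k, (fun c => ((mate c).1, (mate c).2 + 1))^[k] c = c'

/-- The pair of crossing diagonals of a quadrilateral. -/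
def diagonalPair (Q : ι → Fin 4 → V) (p : ι) : Sym2 (Sym2 V) :=
  s(s(Q p 0, Q p 2), s(Q p 1, Q p 3))

theorem mem_diagonalPair {Q : ι → Fin 4 → V} {p : ι} {e : Sym2 V} :
    e ∈ diagonalPair Q p ↔ ∃ i, e = s(Q p i, Q p (i + 2)) := by
  rw [diagonalPair, Sym2.mem_iff]
  constructor
  · rintro (rfl | rfl)
    · exact ⟨0, rfl⟩
    · exact ⟨1, rfl⟩
  · rintro ⟨i, rfl⟩
    fin_cases i
    · exact Or.inl rfl
    · exact Or.inr rfl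
    · exact Or.inl Sym2.eq_swap
    · exact Or.inr Sym2.eq_swap

theorem fin_four_add_two_add_two (i : Fin 4) : i + 2 + 2 = i := by
  revert i
  decide

/-- A function that is constant along a permutation is constant on its cycles. -/
theorem eq_of_sameCycle {α β : Type*} {π : Equiv.Perm α} {f : α → β} (hf : ∀ x, f (π x) = f x)
    {x y : α} (h : π.SameCycle x y) : f x = f y := by
  obtain ⟨i, rfl⟩ := h
  induction i using Int.induction_on with
  | zero => rfl
  | succ n ih => rw [ih, add_comm, zpow_add, zpow_one, Equiv.Perm.mul_apply, hf]
  | pred n ih =>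
    rw [ih, ← hf ((π ^ (-(n : ℤ) - 1)) x), ← Equiv.Perm.mul_apply, ← zpow_one_add]
    congr 3
    ring

namespace IsKiteMap

variable {G : SimpleGraph V} {Q : ι → Fin 4 → V} {mate : ι × Fin 4 → ι × Fin 4}

theorem adj_side (h : IsKiteMap G Q mate) (p : ι) (i : Fin 4) : G.Adj (Q p i) (Q p (i + 1)) :=
  (h.adj_iff _ _).2 ⟨p, i, rfl, Or.inl rfl⟩

theorem adj_diagonal (h : IsKiteMap G Q mate) (p : ι) (i : Fin 4) :
    G.Adj (Q p i) (Q p (i + 2)) :=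
  (h.adj_iff _ _).2 ⟨p, i, rfl, Or.inr rfl⟩

theorem mate_vertex_add_one (h : IsKiteMap G Q mate) (c : ι × Fin 4) :
    Q (mate c).1 ((mate c).2 + 1) = Q c.1 c.2 := by
  rw [← h.mate_vertex, h.mate_mate]

/-- Any two corners are joined by a side or a diagonal, and there are no loops. -/
theorem injective (h : IsKiteMap G Q mate) (p : ι) : Function.Injective (Q p) := by
  intro i j hij
  have h1 := h.adj_side p
  have h2 := h.adj_diagonal p
  have key : j = i ∨ j = i + 1 ∨ j = i + 2 ∨ i = j + 1 := by
    clear hij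
    revert i j
    decide
  rcases key with rfl | rfl | rfl | rfl
  · rfl
  · exact absurd hij (h1 i).ne
  · exact absurd hij (h2 i).ne
  · exact absurd hij.symm (h1 j).ne

theorem diagonalPair_eq_of_mem (h : IsKiteMap G Q mate) {p q : ι} {e : Sym2 V}
    (hp : e ∈ diagonalPair Q p) (hq : e ∈ diagonalPair Q q) : p = q := by
  obtain ⟨i, rfl⟩ := mem_diagonalPair.1 hp
  obtain ⟨j, hj⟩ := mem_diagonalPair.1 hq
  rcases Sym2.eq_iff.1 hj with ⟨h1, h2⟩ | ⟨h1, h2⟩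
  · exact (h.diagonal_inj _ _ _ _ h1 h2).1
  · refine (h.diagonal_inj _ _ q (j + 2) h1 ?_).1
    rw [h2, fin_four_add_two_add_two]

/-- The crossing pattern in which the diagonals of each quadrilateral cross. -/
def pattern (h : IsKiteMap G Q mate) : CrossingPattern G where
  pairs := Set.range (diagonalPair Q)
  isEdge := by
    rintro _ ⟨p, rfl⟩ e he
    obtain ⟨i, rfl⟩ := mem_diagonalPair.1 he
    exact h.adj_diagonal p i
  disjoint := by
    rintro e f ⟨p, hp⟩ w he hf
    have key : ∀ i j : Fin 4, Q p i = Q p j → i = j := h.injective p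
    rcases Sym2.eq_iff.1 hp with ⟨rfl, rfl⟩ | ⟨rfl, rfl⟩ <;>
    · simp only [Sym2.mem_iff] at he hf
      rcases he with rfl | rfl <;> rcases hf with hf | hf <;>
        exact absurd (key _ _ hf) (by decide)
  crossedOnce := by
    rintro _ ⟨p, rfl⟩ _ ⟨q, rfl⟩ e hp hq
    rw [h.diagonalPair_eq_of_mem hp hq]

/-- The crossing of the diagonals of a quadrilateral. -/
def crossing (h : IsKiteMap G Q mate) (p : ι) : h.pattern.pairs := ⟨diagonalPair Q p, p, rfl⟩

theorem crossing_bijective (h : IsKiteMap G Q mate) : Function.Bijective h.crossing := by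
  constructor
  · intro p q hpq
    have : diagonalPair Q p = diagonalPair Q q := congrArg Subtype.val hpq
    refine h.diagonalPair_eq_of_mem (e := s(Q p 0, Q p 2)) (mem_diagonalPair.2 ⟨0, rfl⟩) ?_
    rw [← this]
    exact mem_diagonalPair.2 ⟨0, rfl⟩
  · rintro ⟨_, p, rfl⟩
    exact ⟨p, rfl⟩

theorem planarization_adj_inl_inl (h : IsKiteMap G Q mate) {a b : V} :
    h.pattern.planarization.Adj (Sum.inl a) (Sum.inl b) ↔
      ∃ p i, Q p i = a ∧ Q p (i + 1) = b := by
  change (G.Adj a b ∧ ∀ p ∈ Set.range (diagonalPair Q), s(a, b) ∉ p) ↔ _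
  constructor
  · rintro ⟨h1, h2⟩
    obtain ⟨p, i, rfl, rfl | rfl⟩ := (h.adj_iff a b).1 h1
    · exact ⟨p, i, rfl, rfl⟩
    · exact absurd (mem_diagonalPair.2 ⟨i, rfl⟩) (h2 _ ⟨p, rfl⟩)
  · rintro ⟨p, i, rfl, rfl⟩
    refine ⟨h.adj_side p i, ?_⟩
    rintro _ ⟨q, rfl⟩ hq
    obtain ⟨j, hj⟩ := mem_diagonalPair.1 hq
    rcases Sym2.eq_iff.1 hj with ⟨h1, h2⟩ | ⟨h1, h2⟩
    · exact h.side_ne_diagonal _ _ _ _ h1 h2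
    · refine h.side_ne_diagonal p i q (j + 2) h1 ?_
      rw [h2, fin_four_add_two_add_two]

theorem planarization_adj_inl_inr (h : IsKiteMap G Q mate) {a : V} {p : ι} :
    h.pattern.planarization.Adj (Sum.inl a) (Sum.inr (h.crossing p)) ↔ ∃ i, Q p i = a := by
  change (∃ e ∈ diagonalPair Q p, a ∈ e) ↔ _
  constructor
  · rintro ⟨e, he, ha⟩
    obtain ⟨i, rfl⟩ := mem_diagonalPair.1 he
    rcases Sym2.mem_iff.1 ha with rfl | rfl
    exacts [⟨i, rfl⟩, ⟨i + 2, rfl⟩]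
  · rintro ⟨i, rfl⟩
    exact ⟨_, mem_diagonalPair.2 ⟨i, rfl⟩, by simp⟩

/-- The darts of the triangle that is formed by a side of a quadrilateral and its crossing. -/
def dart (h : IsKiteMap G Q mate) : (ι × Fin 4) × Fin 3 → h.pattern.planarization.Dart
  | (c, 0) => ⟨(Sum.inr (h.crossing c.1), Sum.inl (Q c.1 c.2)),
      (h.planarization_adj_inl_inr.2 ⟨c.2, rfl⟩).symm⟩
  | (c, 1) => ⟨(Sum.inl (Q c.1 c.2), Sum.inl (Q c.1 (c.2 + 1))),
      h.planarization_adj_inl_inl.2 ⟨c.1, c.2, rfl, rfl⟩⟩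
  | (c, 2) => ⟨(Sum.inl (Q c.1 (c.2 + 1)), Sum.inr (h.crossing c.1)),
      h.planarization_adj_inl_inr.2 ⟨c.2 + 1, rfl⟩⟩

/-- Each quadrilateral splits into four triangles with three darts each, and these are all darts of
the planarization. Counting edges and faces is thereby reduced to counting quadrilaterals. -/
theorem dart_bijective (h : IsKiteMap G Q mate) : Function.Bijective h.dart := by
  constructor
  · rintro ⟨⟨p, i⟩, k⟩ ⟨⟨q, j⟩, l⟩ heq
    have h1 : (h.dart ((p, i), k)).fst = (h.dart ((q, j), l)).fst := by rw [heq]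
    have h2 : (h.dart ((p, i), k)).snd = (h.dart ((q, j), l)).snd := by rw [heq]
    fin_cases k <;> fin_cases l <;>
      simp only [dart, Sum.inl.injEq, Sum.inr.injEq, reduceCtorEq] at h1 h2
    · obtain rfl := h.crossing_bijective.1 h1
      rw [h.injective p h2]
    · obtain ⟨rfl, rfl⟩ := h.side_inj _ _ _ _ h1 h2
      rfl
    · obtain rfl := h.crossing_bijective.1 h2
      rw [add_right_cancel (h.injective p h1)]
  · rintro ⟨⟨a | p, b | q⟩, hadj⟩
    · obtain ⟨p, i, rfl, rfl⟩ := h.planarization_adj_inl_inl.1 hadj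
      exact ⟨((p, i), 1), rfl⟩
    · obtain ⟨q, rfl⟩ := h.crossing_bijective.2 q
      obtain ⟨i, rfl⟩ := h.planarization_adj_inl_inr.1 hadj
      refine ⟨((q, i - 1), 2), SimpleGraph.Dart.ext _ _ (Prod.ext ?_ rfl)⟩
      simp [dart]
    · obtain ⟨p, rfl⟩ := h.crossing_bijective.2 p
      obtain ⟨i, rfl⟩ := h.planarization_adj_inl_inr.1 hadj.symm
      exact ⟨((p, i), 0), rfl⟩
    · exact hadj.elim

/-- The permutation of the darts along the triangles. -/
noncomputable def facePerm (h : IsKiteMap G Q mate) :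
    Equiv.Perm h.pattern.planarization.Dart :=
  (Equiv.ofBijective _ h.dart_bijective).permCongr
    (Equiv.prodCongr (Equiv.refl _) (Equiv.addRight (1 : Fin 3)))

theorem facePerm_dart (h : IsKiteMap G Q mate) (c : ι × Fin 4) (k : Fin 3) :
    h.facePerm (h.dart (c, k)) = h.dart (c, k + 1) := by
  have : (Equiv.ofBijective _ h.dart_bijective).symm (h.dart (c, k)) = (c, k) :=
    (Equiv.ofBijective _ h.dart_bijective).symm_apply_apply (c, k)
  simp only [facePerm, Equiv.permCongr_apply, this]
  rfl

/-- The rotation system of the planarization whose faces are the triangles. -/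
noncomputable def rotationPerm (h : IsKiteMap G Q mate) :
    Equiv.Perm h.pattern.planarization.Dart :=
  h.facePerm * reversePerm _

theorem rotationPerm_dart_zero (h : IsKiteMap G Q mate) (p : ι) (i : Fin 4) :
    h.rotationPerm (h.dart ((p, i), 0)) = h.dart ((p, i - 1), 0) := by
  have : (h.dart ((p, i), 0)).symm = h.dart ((p, i - 1), 2) :=
    SimpleGraph.Dart.ext _ _ (Prod.ext (by simp [dart]) rfl)
  rw [rotationPerm, Equiv.Perm.mul_apply, reversePerm_apply, this, facePerm_dart]
  rfl

theorem rotationPerm_dart_one (h : IsKiteMap G Q mate) (c : ι × Fin 4) :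
    h.rotationPerm (h.dart (c, 1)) = h.dart (mate c, 2) := by
  have : (h.dart (c, 1)).symm = h.dart (mate c, 1) :=
    SimpleGraph.Dart.ext _ _ (Prod.ext (by simp [dart, h.mate_vertex])
      (by simp [dart, h.mate_vertex_add_one]))
  rw [rotationPerm, Equiv.Perm.mul_apply, reversePerm_apply, this, facePerm_dart]
  rfl

theorem rotationPerm_dart_two (h : IsKiteMap G Q mate) (c : ι × Fin 4) :
    h.rotationPerm (h.dart (c, 2)) = h.dart ((c.1, c.2 + 1), 1) := by
  have : (h.dart (c, 2)).symm = h.dart ((c.1, c.2 + 1), 0) := rfl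
  rw [rotationPerm, Equiv.Perm.mul_apply, reversePerm_apply, this, facePerm_dart]
  rfl

/-- At a crossing the rotation runs through the four corners. At an original vertex it alternates
between sides and half-diagonals, and two steps make one step of the `rotation` field. -/
theorem isRotationSystem (h : IsKiteMap G Q mate) :
    IsRotationSystem h.pattern.planarization h.rotationPerm := by
  intro d e
  constructor
  · refine eq_of_sameCycle (f := fun d : h.pattern.planarization.Dart => d.fst) fun d => ?_
    obtain ⟨⟨⟨p, i⟩, k⟩, rfl⟩ := h.dart_bijective.2 d
    fin_cases k
    · exact (congrArg (fun d : h.pattern.planarization.Dart => d.fst)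
        (h.rotationPerm_dart_zero p i)).trans rfl
    · refine (congrArg (fun d : h.pattern.planarization.Dart => d.fst)
        (h.rotationPerm_dart_one (p, i))).trans ?_
      simp [dart, h.mate_vertex_add_one]
    · exact (congrArg (fun d : h.pattern.planarization.Dart => d.fst)
        (h.rotationPerm_dart_two (p, i))).trans rfl
  · have hstep : ∀ d, h.rotationPerm.SameCycle d (h.rotationPerm d) := fun d =>
      Equiv.Perm.sameCycle_apply_right.2 (Equiv.Perm.SameCycle.refl _ _)
    have hreal : ∀ c c' : ι × Fin 4, Q c.1 c.2 = Q c'.1 c'.2 →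
        h.rotationPerm.SameCycle (h.dart (c, 1)) (h.dart (c', 1)) := by
      intro c c' hc
      obtain ⟨k, rfl⟩ := h.rotation c c' hc
      clear hc
      induction k generalizing c with
      | zero => exact Equiv.Perm.SameCycle.refl _ _
      | succ k ih =>
        rw [Function.iterate_succ_apply]
        refine Equiv.Perm.SameCycle.trans ?_ (ih _)
        have := (hstep (h.dart (c, 1))).trans (hstep _)
        rwa [h.rotationPerm_dart_one, h.rotationPerm_dart_two] at this
    have htwo : ∀ c : ι × Fin 4,
        h.rotationPerm.SameCycle (h.dart (c, 2)) (h.dart ((c.1, c.2 + 1), 1)) := by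
      intro c
      have := hstep (h.dart (c, 2))
      rwa [h.rotationPerm_dart_two] at this
    have hcross : ∀ p i j, h.rotationPerm.SameCycle (h.dart ((p, i), 0)) (h.dart ((p, j), 0)) := by
      have h1 : ∀ p i, h.rotationPerm.SameCycle (h.dart ((p, i), 0)) (h.dart ((p, i - 1), 0)) := by
        intro p i
        have := hstep (h.dart ((p, i), 0))
        rwa [h.rotationPerm_dart_zero] at this
      have h2 : ∀ p i, h.rotationPerm.SameCycle (h.dart ((p, i), 0)) (h.dart ((p, 0), 0)) := by
        intro p i
        have t1 := h1 p 1
        have t2 := (h1 p 2).trans t1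
        have t3 := (h1 p 3).trans t2
        fin_cases i
        exacts [Equiv.Perm.SameCycle.refl _ _, t1, t2, t3]
      exact fun p i j => (h2 p i).trans (h2 p j).symm
    obtain ⟨⟨⟨p, i⟩, k⟩, rfl⟩ := h.dart_bijective.2 d
    obtain ⟨⟨⟨q, j⟩, l⟩, rfl⟩ := h.dart_bijective.2 e
    intro heq
    fin_cases k <;> fin_cases l <;>
      simp only [dart, Sum.inl.injEq, Sum.inr.injEq, reduceCtorEq] at heq ⊢
    · obtain rfl := h.crossing_bijective.1 heq
      exact hcross p i j
    · exact hreal (p, i) (q, j) heq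
    · exact (hreal (p, i) (q, j + 1) heq).trans (htwo (q, j)).symm
    · exact (htwo (p, i)).trans (hreal (p, i + 1) (q, j) heq)
    · exact ((htwo (p, i)).trans (hreal (p, i + 1) (q, j + 1) heq)).trans (htwo (q, j)).symm

theorem isOppositeAtCrossings (h : IsKiteMap G Q mate) :
    IsOppositeAtCrossings h.pattern h.rotationPerm := by
  intro d r a b hr ha hab
  obtain ⟨⟨⟨p, i⟩, k⟩, rfl⟩ := h.dart_bijective.2 d
  fin_cases k <;> simp only [dart, Sum.inl.injEq, Sum.inr.injEq, reduceCtorEq] at hr ha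
  subst hr ha
  change (h.rotationPerm (h.rotationPerm (h.dart ((p, i), 0)))).snd = _
  rw [h.rotationPerm_dart_zero, h.rotationPerm_dart_zero]
  change Sum.inl (Q p (i - 1 - 1)) = _
  have hab' : s(Q p i, b) ∈ diagonalPair Q p := hab
  obtain ⟨j, hj⟩ := mem_diagonalPair.1 hab'
  congr 1
  rcases Sym2.eq_iff.1 hj with ⟨h1, rfl⟩ | ⟨h1, rfl⟩
  · rw [h.injective p h1]
    congr 1
    clear * -
    revert j
    decide
  · rw [h.injective p h1]
    congr 1
    clear * -
    revert j
    decide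

theorem faceCount_eq (h : IsKiteMap G Q mate) :
    faceCount h.pattern.planarization h.rotationPerm = Nat.card (ι × Fin 4) := by
  have hperm : h.rotationPerm * reversePerm _ = h.facePerm := by
    ext1 d
    simp only [rotationPerm, Equiv.Perm.mul_apply, reversePerm_apply, SimpleGraph.Dart.symm_symm]
  rw [faceCount, hperm]
  symm
  refine Nat.card_congr (Equiv.ofBijective (fun c => Quotient.mk _ (h.dart (c, 0))) ⟨?_, ?_⟩)
  · intro c c' hcc
    have hcyc : h.facePerm.SameCycle (h.dart (c, 0)) (h.dart (c', 0)) := Quotient.exact hcc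
    have hE : ∀ x, (Equiv.ofBijective _ h.dart_bijective).symm (h.dart x) = x :=
      (Equiv.ofBijective _ h.dart_bijective).symm_apply_apply
    have := eq_of_sameCycle
      (f := fun d => ((Equiv.ofBijective _ h.dart_bijective).symm d).1) (fun d => ?_) hcyc
    · simpa only [hE] using this
    · obtain ⟨⟨c, k⟩, rfl⟩ := h.dart_bijective.2 d
      simp only [h.facePerm_dart, hE]
  · intro q
    obtain ⟨d, rfl⟩ := Quotient.exists_rep q
    obtain ⟨⟨c, k⟩, rfl⟩ := h.dart_bijective.2 d
    refine ⟨c, Quotient.sound ?_⟩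
    change h.facePerm.SameCycle _ _
    have hstep : ∀ k, h.facePerm.SameCycle (h.dart (c, k)) (h.dart (c, k + 1)) := by
      intro k
      rw [← h.facePerm_dart]
      exact Equiv.Perm.sameCycle_apply_right.2 (Equiv.Perm.SameCycle.refl _ _)
    fin_cases k
    · exact Equiv.Perm.SameCycle.refl _ _
    · exact hstep 0
    · exact (hstep 0).trans (hstep 1)

theorem planarization_connected (h : IsKiteMap G Q mate) (hG : G.Connected) :
    h.pattern.planarization.Connected := by
  have hadj : ∀ a b, G.Adj a b →
      h.pattern.planarization.Reachable (Sum.inl a) (Sum.inl b) := by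
    intro a b hab
    obtain ⟨p, i, rfl, rfl | rfl⟩ := (h.adj_iff a b).1 hab
    · exact (h.planarization_adj_inl_inl.2 ⟨p, i, rfl, rfl⟩).reachable
    · exact (h.planarization_adj_inl_inr.2 ⟨i, rfl⟩).reachable.trans
        (h.planarization_adj_inl_inr.2 ⟨i + 2, rfl⟩).symm.reachable
  have hinl : ∀ a b, h.pattern.planarization.Reachable (Sum.inl a) (Sum.inl b) := by
    intro a b
    obtain ⟨w⟩ := hG.preconnected a b
    induction w with
    | nil => exact SimpleGraph.Reachable.refl _
    | cons hab _ ih => exact (hadj _ _ hab).trans ih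
  obtain ⟨v⟩ := hG.nonempty
  have hall : ∀ x, h.pattern.planarization.Reachable (Sum.inl v) x := by
    rintro (a | r)
    · exact hinl v a
    · obtain ⟨p, rfl⟩ := h.crossing_bijective.2 r
      exact (hinl v (Q p 0)).trans (h.planarization_adj_inl_inr.2 ⟨0, rfl⟩).reachable
  exact { preconnected := fun x y => (hall x).symm.trans (hall y), nonempty := ⟨Sum.inl v⟩ }

/-- A connected graph with the kites of a quadrangulation of the sphere is optimal 1-planar. -/
theorem isOptimalOnePlanar [Finite V] [Finite ι] (h : IsKiteMap G Q mate) (hG : G.Connected)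
    (hcard : Nat.card V = Nat.card ι + 2) (hV : 3 ≤ Nat.card V) : IsOptimalOnePlanar G := by
  classical
  have := Fintype.ofFinite V
  have := Fintype.ofFinite h.pattern.pairs
  have hpairs : Nat.card h.pattern.pairs = Nat.card ι :=
    (Nat.card_congr (Equiv.ofBijective _ h.crossing_bijective)).symm
  have hdarts : Nat.card h.pattern.planarization.Dart = 12 * Nat.card ι := by
    rw [← Nat.card_congr (Equiv.ofBijective _ h.dart_bijective), Nat.card_prod, Nat.card_prod,
      Nat.card_eq_fintype_card (α := Fin 4), Nat.card_eq_fintype_card (α := Fin 3),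
      Fintype.card_fin, Fintype.card_fin]
    ring
  have hedges : h.pattern.planarization.edgeSet.ncard = 6 * Nat.card ι := by
    rw [Nat.card_eq_fintype_card, SimpleGraph.dart_card_eq_twice_card_edges] at hdarts
    rw [← SimpleGraph.coe_edgeFinset, Set.ncard_coe_finset]
    omega
  have hm := ncard_edgeSet_planarization (C := h.pattern)
  have hiso : {v : V ⊕ h.pattern.pairs | ∀ w, ¬ h.pattern.planarization.Adj v w} = ∅ := by
    rw [Set.eq_empty_iff_forall_notMem]
    rintro (a | r) hx
    · obtain ⟨p, i, rfl⟩ := h.surjective a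
      exact hx _ (h.planarization_adj_inl_inr.2 ⟨i, rfl⟩)
    · obtain ⟨p, rfl⟩ := h.crossing_bijective.2 r
      exact hx _ (h.planarization_adj_inl_inr.2 ⟨0, rfl⟩).symm
  have hcomp : Nat.card h.pattern.planarization.ConnectedComponent = 1 := by
    have hconn := h.planarization_connected hG
    have := hconn.preconnected.subsingleton_connectedComponent
    have := hconn.nonempty
    obtain ⟨x⟩ := this
    exact Nat.card_eq_one_iff_unique.2 ⟨inferInstance,
      ⟨h.pattern.planarization.connectedComponentMk x⟩⟩
  -- With `q` quadrilaterals, `n = q + 2`: Euler's formula reads `(n + q) + 4q = 6q + 2`, and `G`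
  -- has `6q - 2q = 4n - 8` edges.
  refine ⟨hV, ⟨h.pattern, h.rotationPerm, ⟨h.isRotationSystem, ?_⟩, h.isOppositeAtCrossings⟩, ?_⟩
  · rw [h.faceCount_eq, hiso, Set.ncard_empty, hcomp, hedges, Nat.card_sum, hpairs, Nat.card_prod,
      Nat.card_eq_fintype_card (α := Fin 4), Fintype.card_fin, hcard]
    ring
  · omega

end IsKiteMap

end KiteMap

/-! ### A criterion for 5-connectivity that can be checked on tables. -/

section Linkage

variable {V : Type u} {G : SimpleGraph V}

/-- The vertices `u` and `v` cannot be separated by fewer than five other vertices. -/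
def FiveLinked (G : SimpleGraph V) (u v : V) : Prop :=
  ∀ (S : Finset V) (hu : u ∈ (S : Set V)ᶜ) (hv : v ∈ (S : Set V)ᶜ), S.card < 5 →
    (G.induce ((S : Set V)ᶜ)).Reachable ⟨u, hu⟩ ⟨v, hv⟩

theorem FiveLinked.of_adj {u v : V} (h : G.Adj u v) : FiveLinked G u v := fun S hu hv _ =>
  SimpleGraph.Adj.reachable (G := G.induce ((S : Set V)ᶜ)) (u := ⟨u, hu⟩) (v := ⟨v, hv⟩) h

/-- Fewer than five removed vertices miss some `w` in `T`, through which `u` reaches `v`. -/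
theorem FiveLinked.of_common {u v : V} (T : Finset V) (hT : 5 ≤ T.card)
    (h : ∀ w ∈ T, FiveLinked G u w ∧ FiveLinked G w v) : FiveLinked G u v := by
  intro S hu hv hS
  obtain ⟨w, hwT, hwS⟩ := Finset.exists_mem_notMem_of_card_lt_card (hS.trans_le hT)
  have hw : w ∈ (S : Set V)ᶜ := by simpa using hwS
  exact ((h w hwT).1 S hu hw hS).trans ((h w hwT).2 S hw hv hS)

/-- A relation among linked vertices may be extended by pairs with five common neighbours. -/
theorem FiveLinked.extend [Fintype V] [DecidableEq V] {r t : V → V → Bool}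
    (hr : ∀ u v, r u v → FiveLinked G u v)
    (ht : ∀ u v, t u v → r u v ∨ 5 ≤ (Finset.univ.filter fun w => r u w ∧ r w v).card) (u v : V)
    (huv : t u v) : FiveLinked G u v := by
  rcases ht u v huv with h | h
  · exact hr u v h
  · refine FiveLinked.of_common _ h fun w hw => ?_
    rw [Finset.mem_filter] at hw
    exact ⟨hr _ _ hw.2.1, hr _ _ hw.2.2⟩

theorem isKConnected_five_of_linked [Finite V] (hV : 5 < Nat.card V)
    (h : ∀ u v, u ≠ v → FiveLinked G u v) : IsKConnected 5 G := by
  refine ⟨hV, fun S hS => ?_⟩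
  obtain ⟨v, hv⟩ : ∃ v, v ∉ S := by
    by_contra! hcon
    have : Set.univ ⊆ (S : Set V) := fun v _ => hcon v
    have := Set.ncard_le_ncard this S.finite_toSet
    rw [Set.ncard_univ, Set.ncard_coe_finset] at this
    omega
  refine { preconnected := ?_, nonempty := ⟨⟨v, by simpa using hv⟩⟩ }
  rintro ⟨a, ha⟩ ⟨b, hb⟩
  by_cases hab : a = b
  · subst hab
    exact SimpleGraph.Reachable.refl _
  · exact h a b hab S ha hb hS

theorem connected_of_dist_le_two (v : V)
    (h : ∀ w, w = v ∨ G.Adj v w ∨ ∃ z, G.Adj v z ∧ G.Adj z w) : G.Connected := by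
  have hv : ∀ w, G.Reachable v w := by
    intro w
    rcases h w with rfl | h | ⟨z, h₁, h₂⟩
    · exact SimpleGraph.Reachable.refl _
    · exact h.reachable
    · exact h₁.reachable.trans h₂.reachable
  exact { preconnected := fun a b => (hv a).symm.trans (hv b), nonempty := ⟨v⟩ }

end Linkage

/-! ### A 5-connected graph on 13 vertices and its reduction at the vertex 12. -/

section Example

/-- The relation given by the binary digits of the entries of a vector. -/
def bitRel {n : ℕ} (M : Fin n → ℕ) (a b : Fin n) : Bool := (M a).testBit b

/-- Adjacency of a 5-connected optimal 1-planar graph with 13 vertices. -/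
def bigRows : Fin 13 → ℕ :=
  ![2034, 7849, 6488, 6390, 237, 219, 2877, 4155, 3653, 3395, 6915, 5966, 3214]

/-- Adjacency of an optimal 1-planar graph with 12 vertices and the separating 4-cycle
`(0, 1, 2, 6)`. -/
def smallRows : Fin 12 → ℕ :=
  ![2034, 3757, 3546, 246, 237, 219, 2877, 63, 3653, 3395, 2823, 1862]

def bigGraph : SimpleGraph (Fin 13) where
  Adj a b := bitRel bigRows a b
  symm := ⟨by decide +kernel⟩
  loopless := ⟨by decide +kernel⟩

def smallGraph : SimpleGraph (Fin 12) where
  Adj a b := bitRel smallRows a b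
  symm := ⟨by decide +kernel⟩
  loopless := ⟨by decide +kernel⟩

instance : DecidableRel bigGraph.Adj := fun a b =>
  inferInstanceAs (Decidable (bitRel bigRows a b = true))

instance : DecidableRel smallGraph.Adj := fun a b =>
  inferInstanceAs (Decidable (bitRel smallRows a b = true))

/-- The last three quadrilaterals are the kites at the vertex 12. The reduction replaces them by the
last two of `smallQuads`; the first eight are common to both tables. -/
def bigQuads : Fin 11 → Fin 4 → Fin 13 :=
  ![![6, 2, 3, 4], ![7, 5, 4, 3], ![6, 4, 5, 0], ![7, 1, 0, 5], ![8, 9, 10, 11], ![6, 0, 9, 8],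
    ![0, 1, 10, 9], ![2, 6, 8, 11], ![12, 1, 7, 3], ![12, 3, 2, 11], ![12, 11, 10, 1]]

def bigMate (c : Fin 11 × Fin 4) : Fin 11 × Fin 4 :=
  (![![(7, 0), (9, 1), (1, 2), (2, 0)], ![(3, 3), (2, 1), (0, 2), (8, 2)],
    ![(0, 3), (1, 1), (3, 2), (5, 0)], ![(8, 1), (6, 0), (2, 2), (1, 0)],
    ![(5, 2), (6, 2), (10, 1), (7, 2)], ![(2, 3), (6, 3), (4, 0), (7, 1)],
    ![(3, 1), (10, 2), (4, 1), (5, 1)], ![(0, 0), (5, 3), (4, 3), (9, 2)],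
    ![(10, 3), (3, 0), (1, 3), (9, 0)], ![(8, 3), (0, 1), (7, 3), (10, 0)],
    ![(9, 3), (4, 2), (6, 1), (8, 0)]] : Fin 11 → Fin 4 → Fin 11 × Fin 4) c.1 c.2

def smallQuads : Fin 10 → Fin 4 → Fin 12 :=
  ![![6, 2, 3, 4], ![7, 5, 4, 3], ![6, 4, 5, 0], ![7, 1, 0, 5], ![8, 9, 10, 11], ![6, 0, 9, 8],
    ![0, 1, 10, 9], ![2, 6, 8, 11], ![1, 7, 3, 2], ![1, 2, 11, 10]]

def smallMate (c : Fin 10 × Fin 4) : Fin 10 × Fin 4 :=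
  (![![(7, 0), (8, 2), (1, 2), (2, 0)], ![(3, 3), (2, 1), (0, 2), (8, 1)],
    ![(0, 3), (1, 1), (3, 2), (5, 0)], ![(8, 0), (6, 0), (2, 2), (1, 0)],
    ![(5, 2), (6, 2), (9, 2), (7, 2)], ![(2, 3), (6, 3), (4, 0), (7, 1)],
    ![(3, 1), (9, 3), (4, 1), (5, 1)], ![(0, 0), (5, 3), (4, 3), (9, 1)],
    ![(3, 0), (1, 3), (0, 1), (9, 0)], ![(8, 3), (7, 3), (4, 2), (6, 1)]] :
    Fin 10 → Fin 4 → Fin 10 × Fin 4) c.1 c.2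

theorem isKiteMap_bigGraph : IsKiteMap bigGraph bigQuads bigMate where
  adj_iff := by decide +kernel
  mate_mate := by decide +kernel
  mate_vertex := by decide +kernel
  side_inj := by decide +kernel
  diagonal_inj := by decide +kernel
  side_ne_diagonal := by decide +kernel
  surjective := by decide +kernel
  rotation := by
    -- The bound on `k` makes the search finite.
    have : ∀ c c' : Fin 11 × Fin 4, bigQuads c.1 c.2 = bigQuads c'.1 c'.2 →
        ∃ k < 6, (fun c => ((bigMate c).1, (bigMate c).2 + 1))^[k] c = c' := by
      decide +kernel
    intro c c' h
    obtain ⟨k, -, hk⟩ := this c c' h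
    exact ⟨k, hk⟩

theorem isKiteMap_smallGraph : IsKiteMap smallGraph smallQuads smallMate where
  adj_iff := by decide +kernel
  mate_mate := by decide +kernel
  mate_vertex := by decide +kernel
  side_inj := by decide +kernel
  diagonal_inj := by decide +kernel
  side_ne_diagonal := by decide +kernel
  surjective := by decide +kernel
  rotation := by
    have : ∀ c c' : Fin 10 × Fin 4, smallQuads c.1 c.2 = smallQuads c'.1 c'.2 →
        ∃ k < 6, (fun c => ((smallMate c).1, (smallMate c).2 + 1))^[k] c = c' := by
      decide +kernel
    intro c c' h
    obtain ⟨k, -, hk⟩ := this c c' h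
    exact ⟨k, hk⟩

theorem isOptimalOnePlanar_bigGraph : IsOptimalOnePlanar bigGraph :=
  isKiteMap_bigGraph.isOptimalOnePlanar
    (connected_of_dist_le_two 0 (by decide +kernel)) (by simp) (by simp)

theorem isOptimalOnePlanar_smallGraph : IsOptimalOnePlanar smallGraph :=
  isKiteMap_smallGraph.isOptimalOnePlanar
    (connected_of_dist_le_two 0 (by decide +kernel)) (by simp) (by simp)

theorem isKConnected_bigGraph : IsKConnected 5 bigGraph := by
  refine isKConnected_five_of_linked (by simp) ?_
  -- Each table lists pairs that lie in the previous one or have five common partners there. It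
  -- starts with adjacency, and the fifth round reaches all pairs of distinct vertices.
  have h₁ := FiveLinked.extend (G := bigGraph) (r := bitRel bigRows) (t := bitRel ![4090, 7913,
    6488, 6391, 237, 219, 2879, 4155, 3653, 3395, 6915, 5967, 3214])
    (fun _ _ h => FiveLinked.of_adj (G := bigGraph) h) (by decide +kernel)
  have h₂ := FiveLinked.extend (t := bitRel ![8190, 8185, 6489, 6391, 239, 219, 4031, 4219, 3655,
    3395, 6979, 5967, 3215]) h₁ (by decide +kernel)
  have h₃ := FiveLinked.extend (t := bitRel ![8190, 8189, 7643, 7671, 6383, 219, 8127, 6271, 7759,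
    3395, 6991, 6111, 3551]) h₂ (by decide +kernel)
  have h₄ := FiveLinked.extend (t := bitRel ![8190, 8189, 8187, 8183, 7663, 6367, 8127, 7551, 7903,
    7503, 7135, 6143, 4095]) h₃ (by decide +kernel)
  have h₅ := FiveLinked.extend (t := fun u v => decide (u ≠ v)) h₄ (by decide +kernel)
  exact fun u v huv => h₅ u v (decide_eq_true huv)

theorem not_isKConnected_smallGraph : ¬ IsKConnected 5 smallGraph := by
  rintro ⟨-, h⟩
  have hconn := (h {0, 1, 2, 6} (by decide)).preconnected ⟨3, by simp⟩ ⟨8, by simp⟩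
  obtain ⟨w⟩ := hconn
  -- Without `0, 1, 2, 6`, no edge leaves `{3, 4, 5, 7}`, so 3 cannot reach 8.
  have hclosed : ∀ a b : Fin 12, a ∉ ({0, 1, 2, 6} : Finset (Fin 12)) →
      b ∉ ({0, 1, 2, 6} : Finset (Fin 12)) → smallGraph.Adj a b →
      a ∈ ({3, 4, 5, 7} : Finset (Fin 12)) → b ∈ ({3, 4, 5, 7} : Finset (Fin 12)) := by
    decide +kernel
  have key : ∀ {a b} (w : (smallGraph.induce
      ((({0, 1, 2, 6} : Finset (Fin 12)) : Set (Fin 12))ᶜ)).Walk a b),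
      a.1 ∈ ({3, 4, 5, 7} : Finset (Fin 12)) → b.1 ∈ ({3, 4, 5, 7} : Finset (Fin 12)) := by
    intro a b w
    induction w with
    | nil => exact id
    | @cons a b c hab _ ih => exact fun ha => ih (hclosed a.1 b.1 a.2 b.2 hab ha)
  exact absurd (key w (by decide)) (by decide)

/-- The crossed star at the vertex `12`. -/
def bigStar : CrossedStar bigGraph where
  x := 12
  x₁ := 1
  x₂ := 7
  x₃ := 3
  x₄ := 2
  x₅ := 11
  x₆ := 10
  distinct := by decide
  neighbors := by
    have h : ∀ v : Fin 13, bigGraph.Adj 12 v ↔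
        v = 1 ∨ v = 7 ∨ v = 3 ∨ v = 2 ∨ v = 11 ∨ v = 10 := by decide +kernel
    ext v
    simpa using h v
  adj₁₂ := by decide +kernel
  adj₂₃ := by decide +kernel
  adj₃₄ := by decide +kernel
  adj₄₅ := by decide +kernel
  adj₅₆ := by decide +kernel
  adj₆₁ := by decide +kernel
  adj₁₃ := by decide +kernel
  adj₃₅ := by decide +kernel
  adj₅₁ := by decide +kernel

theorem srStep_bigGraph_smallGraph : SRStep bigGraph smallGraph := by
  refine ⟨bigStar, ⟨by decide +kernel, by decide +kernel, by decide +kernel⟩, ⟨?_⟩⟩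
  -- The deleted vertex is the last one, so the others keep their numbers and the isomorphism is
  -- `Fin.castSucc`.
  have hadj : ∀ a b : Fin 12,
      ((bigGraph.Adj a.castSucc b.castSucc ∧ s(a.castSucc, b.castSucc) ≠ s(3, 11)) ∨
        (s(a.castSucc, b.castSucc) = s(2, 1) ∨ s(a.castSucc, b.castSucc) = s(2, 7) ∨
          s(a.castSucc, b.castSucc) = s(2, 10)) ∧ a.castSucc ≠ b.castSucc) ↔
      smallGraph.Adj a b := by
    decide +kernel
  have hne : ∀ a : Fin 12, a.castSucc ∈ ({bigStar.x} : Set (Fin 13))ᶜ := fun a =>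
    (Fin.castSucc_lt_last a).ne
  let f : Fin 12 → (({bigStar.x} : Set (Fin 13))ᶜ : Set (Fin 13)) := fun a => ⟨a.castSucc, hne a⟩
  have hf : Function.Bijective f := by
    constructor
    · intro a b hab
      exact Fin.castSucc_injective _ (congrArg Subtype.val hab)
    · rintro ⟨a, ha⟩
      obtain ⟨b, rfl⟩ := Fin.exists_castSucc_eq.2 (show a ≠ Fin.last 12 from ha)
      exact ⟨b, rfl⟩
  refine RelIso.symm ⟨Equiv.ofBijective f hf, ?_⟩
  intro a b
  exact bigStar.reduct_adj_iff.trans (hadj a b)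

end Example

end OptimalOnePlanar

theorem mainTheorem9 :
    (∃ (n m : ℕ) (G : SimpleGraph (Fin n)) (G' : SimpleGraph (Fin m)),
      OptimalOnePlanar.IsOptimalOnePlanar G ∧ OptimalOnePlanar.IsKConnected 5 G ∧
        OptimalOnePlanar.SRStep G G' ∧
        OptimalOnePlanar.IsOptimalOnePlanar G' ∧ ¬ OptimalOnePlanar.IsKConnected 5 G') ∧
    (∀ (V W : Type u) [Finite V] (G : SimpleGraph V) (H : SimpleGraph W),
      OptimalOnePlanar.IsOptimalOnePlanar G → OptimalOnePlanar.HasSeparatingFourCycle G →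
        OptimalOnePlanar.SRReducesTo G H → ¬ OptimalOnePlanar.IsExtendedWheel H) := by
  refine ⟨⟨13, 12, OptimalOnePlanar.bigGraph, OptimalOnePlanar.smallGraph,
    OptimalOnePlanar.isOptimalOnePlanar_bigGraph, OptimalOnePlanar.isKConnected_bigGraph,
    OptimalOnePlanar.srStep_bigGraph_smallGraph, OptimalOnePlanar.isOptimalOnePlanar_smallGraph,
    OptimalOnePlanar.not_isKConnected_smallGraph⟩, ?_⟩
  rintro V W _ G H hG hsep hred ⟨k, hk, ⟨e⟩⟩
  exact OptimalOnePlanar.not_hasSmallCut_extendedWheel hk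
    ((hred.hasSmallCut hG.hasKiteCover hsep.hasSmallCut).2.of_iso e)
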